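/- Let $\Omega\subset\mathbb R^n$ be open, $\delta>0$, $I_\delta=(-\delta,\delta)$, $I_\delta^+=(0,\delta)$, $I_\delta^-=(-\delta,0)$, $\Omega_\delta=I_\delta\times\Omega$ and $\Omega_\delta^\pm=I_\delta^\pm\times\Omega$. Let $X=a(t,x)\partial_t+\sum_{j=1}^n a_j(t,x)\partial_{x_j}$ have coefficients in $C^\infty(\Omega_\delta)$, with $a(0,x)=0$ for all $x\in\Omega$, so that $t=0$ is characteristic. Let $X^*\varphi=-\partial_t(a\varphi)-\sum_j\partial_{x_j}(a_j\varphi)$ be the formal transpose of $X$. (1) Let $b,f\in C^\infty(\Omega_\delta)$, and let $u^\pm\in C^\infty(\Omega_\delta^\pm)$ satisfy $Xu^\pm+bu^\pm=f$ in $\Omega_\delta^\pm$. Suppose that $u^\pm\in L^1(I_\delta^\pm\times K)$ for every compact $K\subset\Omega$, and that $$\lim_{t\to0^\pm}\int_{\mathbb R^n}a(t,x)u^\pm(t,x)\varphi(t,x)\,dx=0\qquad\text{for all }\varphi\in C_0^\infty(\Omega_\delta).$$ Then the function $u$ that equals $u^+$ in $\Omega_\delta^+$ and $u^-$ in $\Omega_\delta^-$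 belongs to $L^1_{loc}(\Omega_\delta)$, and to $L^1(I_\delta\times K)$ for every compact $K\subset\Omega$, and it is a distributional solution of $Xu+bu=f$ in $\Omega_\delta$, i.e. $\int_{\Omega_\delta}u\,(X^*\varphi+b\varphi)\,dt\,dx=\int_{\Omega_\delta}f\varphi\,dt\,dx$ for all $\varphi\in C_0^\infty(\Omega_\delta)$. (2) Let $\Omega=\mathbb R^n$, $s_1,s_2\in\mathbb R$, and let $H^{s_1,s_2}=H^{s_1,s_2}(\mathbb R^n)$ be the space of all $v\in\mathcal S'(\mathbb R^n)$ with $\|v\|_{s_1,s_2}=\|\langle x\rangle^{s_2}\langle D\rangle^{s_1}v\|_{L^2}<\infty$, where $\langle x\rangle=(1+|x|^2)^{1/2}$. Let $b$ be either a function in $C^\infty(I_\delta\times\mathbb R^n)$, or a pseudodifferential operator $b(t,x,D)$ of order zero in $x$ depending smoothly on $t\in I_\delta$: its symbol $b(t,x,\xi)$ is smooth, and for all $k,\alpha,\beta$ one has $|\partial_t^k\partial_x^\alpha\partial_\xi^\beta b(t,x,\xi)|\le C\langle x\rangle^{-|\alpha|}\langle\xi\rangle^{-|\beta|}$, uniformly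 for $t$ in compact subsets of $I_\delta$. Let $b^*$ be its transpose in $x$. For an interval $I\subset I_\delta$, a curve $u$ in $H^{s_1,s_2}$ is called a distributional solution of $Xu+bu=f$ in $I\times\mathbb R^n$ if $$\int_I\langle u(t),(X^*\varphi)(t,\cdot)+b^*(t)\varphi(t,\cdot)\rangle\,dt=\int_I\langle f(t),\varphi(t,\cdot)\rangle\,dt\qquad\text{for all }\varphi\in C_0^\infty(I\times\mathbb R^n).$$ Let $f\in C(I_\delta:H^{s_1,s_2})$, and let $u^\pm\in C(I_\delta^\pm:H^{s_1,s_2})\cap L^1(I_\delta^\pm:H^{s_1,s_2})$ be distributional solutions of $Xu^\pm+bu^\pm=f$ in $I_\delta^\pm\times\mathbb R^n$ such that $$\lim_{t\to0^\pm}\langle u^\pm(t),a(t,\cdot)\varphi(t,\cdot)\rangle=0\qquad\text{for all }\varphi\in C_0^\infty(I_\delta\times\mathbb R^n).$$ Then the curve $u$ that equals $u^+$ for $t>0$ and $u^-$ for $t<0$ belongs to $L^1(I_\delta:H^{s_1,s_2})$ and is a distributional solution of $Xu+bu=f$ in $I_\delta\times\mathbb R^n$. -/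

import Mathlib

open MeasureTheory Set Filter Topology
open scoped ContDiff SchwartzMap FourierTransform

noncomputable section

namespace Gluing

/-- The space `ℝⁿ` of the variable `x`. -/
abbrev E (n : ℕ) : Type := EuclideanSpace ℝ (Fin n)

/-- The domain `I × Ω` in the variables `(t, x)`. -/
def cyl {n : ℕ} (I : Set ℝ) (Ω : Set (E n)) : Set (ℝ × E n) := I ×ˢ Ω

/-- `φ ∈ C₀^∞(W)`. -/
structure IsTest {n : ℕ} (W : Set (ℝ × E n)) (φ : ℝ × E n → ℂ) : Prop where
  smooth : ContDiff ℝ ∞ φ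
  compact : HasCompactSupport φ
  supp : tsupport φ ⊆ W

/-- The partial derivative `∂_t v`. -/
def dt {n : ℕ} (v : ℝ × E n → ℂ) (p : ℝ × E n) : ℂ := fderiv ℝ v p (1, 0)

/-- The partial derivative `∂_{x_j} v`. -/
def dx {n : ℕ} (j : Fin n) (v : ℝ × E n → ℂ) (p : ℝ × E n) : ℂ :=
  fderiv ℝ v p (0, EuclideanSpace.single j 1)

/-- The vector field `X = a ∂_t + ∑_j A_j ∂_{x_j}` acting on functions. -/
def vf {n : ℕ} (a : ℝ × E n → ℂ) (A : Fin n → ℝ × E n → ℂ) (v : ℝ × E n → ℂ)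
    (p : ℝ × E n) : ℂ :=
  a p * dt v p + ∑ j, A j p * dx j v p

/-- The formal transpose `X^* φ = - ∂_t (a φ) - ∑_j ∂_{x_j} (A_j φ)`, with respect to the
bilinear pairing `∫ u φ`. -/
def vfTranspose {n : ℕ} (a : ℝ × E n → ℂ) (A : Fin n → ℝ × E n → ℂ) (φ : ℝ × E n → ℂ)
    (p : ℝ × E n) : ℂ :=
  -dt (fun q => a q * φ q) p - ∑ j, dx j (fun q => A j q * φ q) p

/-- The function equal to `u⁺` for `t > 0` and to `u⁻` for `t < 0` (its value on `t = 0`, a set of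
measure zero, is irrelevant). -/
def glue {n : ℕ} (up um : ℝ × E n → ℂ) (p : ℝ × E n) : ℂ :=
  if 0 < p.1 then up p else if p.1 < 0 then um p else 0

/-- The curve of tempered distributions equal to `u⁺(t)` for `t > 0` and to `u⁻(t)` for `t < 0`. -/
def glueDist {n : ℕ} (up um : ℝ → 𝓢'(E n, ℂ)) (t : ℝ) : 𝓢'(E n, ℂ) :=
  if 0 < t then up t else if t < 0 then um t else 0

/-- `u` is a distributional solution of `X u + b u = f` in the open set `W`, for functions `u`, `f`
that are locally integrable in `W`. -/
def IsDistSol {n : ℕ} (W : Set (ℝ × E n)) (a : ℝ × E n → ℂ) (A : Fin n → ℝ × E n → ℂ)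
    (b f u : ℝ × E n → ℂ) : Prop :=
  ∀ φ : ℝ × E n → ℂ, IsTest W φ →
    ∫ p in W, u p * (vfTranspose a A φ p + b p * φ p) = ∫ p in W, f p * φ p

/-- The bracket `⟨x⟩ = (1 + ‖x‖²)^{1/2}`. -/
def bracket {n : ℕ} (x : E n) : ℝ := Real.sqrt (1 + ‖x‖ ^ 2)

/-- The operator `⟨x⟩^{s₂} ⟨D⟩^{s₁}` on tempered distributions, where `D = -i ∂_x`. In Mathlib's
normalization of the Fourier transform, `D` is the multiplier `2πξ`. -/
def sobolevOp {n : ℕ} (s₁ s₂ : ℝ) (v : 𝓢'(E n, ℂ)) : 𝓢'(E n, ℂ) :=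
  TemperedDistribution.smulLeftCLM ℂ (fun x : E n => (((1 + ‖x‖ ^ 2) ^ (s₂ / 2) : ℝ) : ℂ))
    (TemperedDistribution.fourierMultiplierCLM ℂ
      (fun ξ : E n => (((1 + (2 * Real.pi) ^ 2 * ‖ξ‖ ^ 2) ^ (s₁ / 2) : ℝ) : ℂ)) v)

/-- `v ∈ H^{s₁,s₂}(ℝⁿ)`, and `g ∈ L²` is the function `⟨x⟩^{s₂} ⟨D⟩^{s₁} v`; so the norm of `v` in
`H^{s₁,s₂}` is `‖g‖`, and `v ↦ g` is a linear isometry of `H^{s₁,s₂}` onto `L²`. -/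
def IsSobolevRep {n : ℕ} (s₁ s₂ : ℝ) (v : 𝓢'(E n, ℂ))
    (g : Lp ℂ 2 (volume : Measure (E n))) : Prop :=
  sobolevOp s₁ s₂ v = Lp.toTemperedDistribution g

/-- `u ∈ C(I : H^{s₁,s₂}(ℝⁿ))`. -/
def ContinuousSobolev {n : ℕ} (I : Set ℝ) (s₁ s₂ : ℝ) (u : ℝ → 𝓢'(E n, ℂ)) : Prop :=
  ∃ g : ℝ → Lp ℂ 2 (volume : Measure (E n)),
    ContinuousOn g I ∧ ∀ t ∈ I, IsSobolevRep s₁ s₂ (u t) (g t)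

/-- `u ∈ L¹(I : H^{s₁,s₂}(ℝⁿ))` (Bochner integrability). -/
def IntegrableSobolev {n : ℕ} (I : Set ℝ) (s₁ s₂ : ℝ) (u : ℝ → 𝓢'(E n, ℂ)) : Prop :=
  ∃ g : ℝ → Lp ℂ 2 (volume : Measure (E n)),
    IntegrableOn g I ∧ ∀ᵐ t ∂(volume.restrict I), IsSobolevRep s₁ s₂ (u t) (g t)

open Classical in
/-- The value `⟨v, g⟩` of a tempered distribution on a Schwartz function `g`, which is given as a
plain function (the value is `0` if `g` is not a Schwartz function). -/
def pair {n : ℕ} (v : 𝓢'(E n, ℂ)) (g : E n → ℂ) : ℂ :=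
  if h : ∃ ψ : 𝓢(E n, ℂ), ⇑ψ = g then v h.choose else 0

/-- The symbols of order zero in `x` that depend smoothly on `t ∈ I`: `σ(t, x, ξ)` is smooth, and
each `∂_t^k ∂_x^α ∂_ξ^β σ` is `O(⟨x⟩^{-|α|} ⟨ξ⟩^{-|β|})`, locally uniformly in `t ∈ I`. -/
structure IsSymbolZero {n : ℕ} (I : Set ℝ) (σ : ℝ → E n → E n → ℂ) : Prop where
  smooth : ContDiffOn ℝ ∞ (fun p : ℝ × E n × E n => σ p.1 p.2.1 p.2.2) (I ×ˢ univ)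
  bound : ∀ k i j : ℕ, ∀ J : Set ℝ, IsCompact J → J ⊆ I → ∃ C : ℝ, ∀ t ∈ J, ∀ x ξ : E n,
    bracket x ^ i * bracket ξ ^ j *
      ‖iteratedDeriv k (fun t' => iteratedFDeriv ℝ i
        (fun x' => iteratedFDeriv ℝ j (fun ξ' => σ t' x' ξ') ξ) x) t‖ ≤ C

/-- The transpose of the pseudodifferential operator `σ(x, D)`,
`σ(x, D) v (x) = (2π)^{-n} ∫ e^{i x·ξ} σ(x, ξ) v̂(ξ) dξ`, with `v̂(ξ) = ∫ e^{-i x·ξ} v(x) dx`.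
It is `σ(x, D)^* φ (y) = (2π)^{-n} ∫ e^{-i y·ξ} (∫ e^{i x·ξ} σ(x, ξ) φ(x) dx) dξ`, which becomes the
formula below after the substitution of `2πξ` for `ξ`. For a symbol of order zero it maps Schwartz
functions to Schwartz functions, and `σ(x, D)` acts on tempered distributions by
`⟨σ(x, D) v, φ⟩ = ⟨v, σ(x, D)^* φ⟩`. -/
def pdoTranspose {n : ℕ} (σ : E n → E n → ℂ) (φ : E n → ℂ) : E n → ℂ :=
  𝓕 (fun ξ : E n => 𝓕⁻ (fun x : E n => σ x ((2 * Real.pi) • ξ) * φ x) ξ)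

/-- The term `b`: a function `b(t, x)`, or a pseudodifferential operator `b(t, x, D)` in `x`. -/
inductive ZeroTerm (n : ℕ) : Type
  | mul (b : ℝ × E n → ℂ) : ZeroTerm n
  | pdo (σ : ℝ → E n → E n → ℂ) : ZeroTerm n

/-- `b ∈ C^∞(I × ℝⁿ)`, or `b` is a pseudodifferential operator of order zero in `x` that depends
smoothly on `t ∈ I`. -/
def ZeroTerm.Admissible {n : ℕ} (I : Set ℝ) : ZeroTerm n → Prop
  | .mul b => ContDiffOn ℝ ∞ b (cyl I univ)
  | .pdo σ => IsSymbolZero I σ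

/-- The transpose `b(t)^*`, acting on functions of `x`. -/
def ZeroTerm.transpose {n : ℕ} (t : ℝ) (g : E n → ℂ) : ZeroTerm n → E n → ℂ
  | .mul b => fun x => b (t, x) * g x
  | .pdo σ => pdoTranspose (σ t) g

/-- `u` is a distributional solution of `X u + b u = f` in `I × ℝⁿ`, for curves `u`, `f` of tempered
distributions: `∫ ⟨u(t), X^* φ(t,·) + b(t)^* φ(t,·)⟩ dt = ∫ ⟨f(t), φ(t,·)⟩ dt` for all test
functions. -/
def IsDistSolCurve {n : ℕ} (I : Set ℝ) (a : ℝ × E n → ℂ) (A : Fin n → ℝ × E n → ℂ)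
    (b : ZeroTerm n) (f u : ℝ → 𝓢'(E n, ℂ)) : Prop :=
  ∀ φ : ℝ × E n → ℂ, IsTest (cyl I univ) φ →
    ∫ t in I, (pair (u t) (fun x => vfTranspose a A φ (t, x)) +
        pair (u t) (b.transpose t (fun x => φ (t, x)))) =
      ∫ t in I, pair (f t) (fun x => φ (t, x))

end Gluing

end

/-!
Let `φ` be a test function on the whole domain. Multiplied by a cutoff `χ(t)` that vanishes near
`t = 0`, it becomes a test function on the two sides, where the equation is assumed. Since
`X^*(χ φ) = χ X^* φ - χ' a φ`, cutting off an `ε`-neighbourhood of `t = 0` leaves the error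
`∫ χ_ε'(t) ⟨u(t), a(t, ·) φ(t, ·)⟩ dt` with `χ_ε' = O(1 / ε)` supported in `|t| ≤ 2ε`, which tends
to zero by the flux hypothesis.

For curves in `H^{s₁,s₂}` the remaining point is that `⟨u(t), b(t)^* φ(t, ·)⟩` is integrable in `t`.
The curve `t ↦ b(t)^* φ(t, ·)` is bounded in the Schwartz space and measurable: it is the Fourier
transform of an oscillatory integral whose amplitude `σ φ` is compactly supported in `x`, and this
class of integrals is closed under `∂_ξ` (differentiate the amplitude) and under multiplication by
`ξ` (integrate by parts in `x`).
-/

noncomputable section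

namespace Gluing

section Cutoff

/-- A smooth function of `t` that vanishes near `t₀` and equals `1` where `2 ε ≤ |t - t₀|`. -/
def cutoff (t₀ ε t : ℝ) : ℝ :=
  1 - (⟨1, 2, one_pos, one_lt_two⟩ : ContDiffBump (0 : ℝ)) ((t - t₀) / ε)

variable {t₀ ε t : ℝ}

theorem contDiff_cutoff : ContDiff ℝ ∞ (cutoff t₀ ε) :=
  contDiff_const.sub
    ((ContDiffBump.contDiff _).comp ((contDiff_id.sub contDiff_const).div_const _))

theorem cutoff_eq_zero (hε : 0 < ε) (ht : |t - t₀| ≤ ε) : cutoff t₀ ε t = 0 := by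
  rw [cutoff, ContDiffBump.one_of_mem_closedBall, sub_self]
  simpa [abs_div, abs_of_pos hε] using (div_le_one hε).2 ht

theorem cutoff_eq_one (hε : 0 < ε) (ht : 2 * ε ≤ |t - t₀|) : cutoff t₀ ε t = 1 := by
  rw [cutoff, ContDiffBump.zero_of_le_dist, sub_zero]
  simpa [abs_div, abs_of_pos hε] using (le_div_iff₀ hε).2 ht

theorem abs_cutoff_le_one : |cutoff t₀ ε t| ≤ 1 := by
  let ρ : ContDiffBump (0 : ℝ) := ⟨1, 2, one_pos, one_lt_two⟩
  change |1 - ρ ((t - t₀) / ε)| ≤ 1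
  rw [abs_of_nonneg (sub_nonneg.2 ρ.le_one)]
  exact sub_le_self _ ρ.nonneg

theorem notMem_tsupport_cutoff (hε : 0 < ε) : t₀ ∉ tsupport (cutoff t₀ ε) := by
  rw [notMem_tsupport_iff_eventuallyEq]
  filter_upwards [Metric.ball_mem_nhds t₀ hε] with t ht
  exact cutoff_eq_zero hε (Metric.mem_ball.1 ht).le

theorem exists_abs_deriv_cutoff_le :
    ∃ C, 0 ≤ C ∧ ∀ t₀ ε t : ℝ, 0 < ε → |deriv (cutoff t₀ ε) t| ≤ C / ε := by
  let ρ : ContDiffBump (0 : ℝ) := ⟨1, 2, one_pos, one_lt_two⟩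
  obtain ⟨C, hC⟩ := (ρ.contDiff.continuous_deriv le_rfl).bounded_above_of_compact_support
    ρ.hasCompactSupport.deriv
  refine ⟨C, (norm_nonneg _).trans (hC 0), fun t₀ ε t hε => ?_⟩
  have hderiv : HasDerivAt (cutoff t₀ ε) (-(deriv ρ ((t - t₀) / ε) * (1 / ε))) t :=
    (((ρ.contDiff (n := 1)).differentiable one_ne_zero _).hasDerivAt.comp t
      (((hasDerivAt_id t).sub_const t₀).div_const ε)).const_sub 1
  rw [hderiv.deriv, abs_neg, abs_mul, abs_of_pos (one_div_pos.2 hε), mul_one_div]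
  gcongr
  exact hC _

theorem deriv_cutoff_eq_zero (hε : 0 < ε) (ht : 2 * ε < |t - t₀|) :
    deriv (cutoff t₀ ε) t = 0 := by
  have hone : cutoff t₀ ε =ᶠ[𝓝 t] fun _ => 1 := by
    filter_upwards [(continuous_abs.comp (continuous_sub_right t₀)).continuousAt.eventually
      (lt_mem_nhds ht)] with s hs
    exact cutoff_eq_one hε hs.le
  rw [hone.deriv_eq, deriv_const]

variable {F : Type*} [NormedAddCommGroup F] [NormedSpace ℝ F] {P R S : ℝ → F}

theorem integrable_cutoff_smul (hP : Integrable P) :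
    Integrable fun t => cutoff t₀ ε t • P t :=
  hP.bdd_smul 1 contDiff_cutoff.continuous.aestronglyMeasurable
    (Eventually.of_forall fun _ => abs_cutoff_le_one)

theorem integrable_deriv_cutoff_smul (hε : 0 < ε) (hS : Integrable S) :
    Integrable fun t => deriv (cutoff t₀ ε) t • S t := by
  obtain ⟨C, -, hC⟩ := exists_abs_deriv_cutoff_le
  exact hS.bdd_smul (C / ε) (contDiff_cutoff.continuous_deriv (by simp)).aestronglyMeasurable
    (Eventually.of_forall fun t => hC t₀ ε t hε)

theorem tendsto_integral_cutoff_smul (t₀ : ℝ) (hP : Integrable P) :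
    Tendsto (fun ε => ∫ t, cutoff t₀ ε t • P t) (𝓝[>] 0) (𝓝 (∫ t, P t)) := by
  refine tendsto_integral_filter_of_dominated_convergence (fun t => ‖P t‖)
    (Eventually.of_forall fun _ => (integrable_cutoff_smul hP).aestronglyMeasurable)
    (Eventually.of_forall fun ε => Eventually.of_forall fun t => ?_) hP.norm ?_
  · rw [norm_smul]
    exact mul_le_of_le_one_left (norm_nonneg _) abs_cutoff_le_one
  · filter_upwards [Measure.ae_ne volume t₀] with t ht
    have hpos : 0 < |t - t₀| / 2 := half_pos (abs_pos.2 (sub_ne_zero.2 ht))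
    apply tendsto_const_nhds.congr'
    filter_upwards [Ioo_mem_nhdsGT hpos] with ε hε
    rw [cutoff_eq_one hε.1 (by linarith [hε.2]), one_smul]

theorem tendsto_integral_deriv_cutoff_smul (hS : Tendsto S (𝓝[≠] t₀) (𝓝 0)) :
    Tendsto (fun ε => ∫ t, deriv (cutoff t₀ ε) t • S t) (𝓝[>] 0) (𝓝 0) := by
  obtain ⟨C, hC0, hC⟩ := exists_abs_deriv_cutoff_le
  rw [Metric.tendsto_nhds]
  intro η hη
  have hκ : 0 < η / (4 * C + 1) := by positivity
  obtain ⟨r, hr, hSr⟩ := Metric.eventually_nhds_iff.1 <| eventually_nhdsWithin_iff.1 <|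
    Metric.tendsto_nhds.1 hS _ hκ
  filter_upwards [Ioo_mem_nhdsGT (half_pos hr)] with ε ⟨hε, hεr⟩
  have hsupp : ∫ t, deriv (cutoff t₀ ε) t • S t =
      ∫ t in Metric.closedBall t₀ (2 * ε), deriv (cutoff t₀ ε) t • S t := by
    refine (setIntegral_eq_integral_of_forall_compl_eq_zero fun t ht => ?_).symm
    rw [deriv_cutoff_eq_zero hε (by simpa [Real.dist_eq] using ht), zero_smul]
  have hbound : ∀ᵐ t ∂volume.restrict (Metric.closedBall t₀ (2 * ε)),
      ‖deriv (cutoff t₀ ε) t • S t‖ ≤ C / ε * (η / (4 * C + 1)) := by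
    filter_upwards [ae_restrict_mem measurableSet_closedBall,
      ae_restrict_of_ae (Measure.ae_ne volume t₀)] with t ht htne
    rw [norm_smul]
    gcongr
    · exact hC t₀ ε t hε
    · simpa using (hSr (by linarith [Metric.mem_closedBall.1 ht]) htne).le
  rw [dist_zero_right, hsupp]
  calc _ ≤ C / ε * (η / (4 * C + 1)) * volume.real (Metric.closedBall t₀ (2 * ε)) :=
        norm_setIntegral_le_of_norm_le_const_ae measure_closedBall_lt_top hbound
    _ = 4 * C * (η / (4 * C + 1)) := by
        rw [Real.volume_real_closedBall (by positivity)]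
        field_simp
        ring
    _ < (4 * C + 1) * (η / (4 * C + 1)) := by linarith
    _ = η := by field_simp

theorem integral_eq_of_forall_cutoff (hP : Integrable P) (hR : Integrable R) (hS : Integrable S)
    (hS0 : Tendsto S (𝓝[≠] t₀) (𝓝 0))
    (h : ∀ χ : ℝ → ℝ, ContDiff ℝ ∞ χ → t₀ ∉ tsupport χ →
      ∫ t, (χ t • P t - deriv χ t • S t) = ∫ t, χ t • R t) :
    ∫ t, P t = ∫ t, R t := by
  have hlim := (tendsto_integral_cutoff_smul t₀ hP).sub (tendsto_integral_deriv_cutoff_smul hS0)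
  rw [sub_zero] at hlim
  refine tendsto_nhds_unique (hlim.congr' ?_) (tendsto_integral_cutoff_smul t₀ hR)
  filter_upwards [self_mem_nhdsWithin] with ε hε
  rw [← integral_sub (integrable_cutoff_smul hP) (integrable_deriv_cutoff_smul hε hS)]
  exact h _ contDiff_cutoff (notMem_tsupport_cutoff hε)

end Cutoff

theorem contDiff_of_forall_mem_tsupport {𝕜 V F : Type*} [NontriviallyNormedField 𝕜]
    [NormedAddCommGroup V] [NormedSpace 𝕜 V] [NormedAddCommGroup F] [NormedSpace 𝕜 F]
    {m : WithTop ℕ∞} {g : V → F} (h : ∀ x ∈ tsupport g, ContDiffAt 𝕜 m g x) : ContDiff 𝕜 m g := by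
  refine contDiff_iff_contDiffAt.2 fun x => ?_
  by_cases hx : x ∈ tsupport g
  · exact h x hx
  · exact contDiffAt_const.congr_of_eventuallyEq (notMem_tsupport_iff_eventuallyEq.1 hx)

section Tests

variable {n : ℕ} {U V W : Set (ℝ × E n)} {φ ψ a b c : ℝ × E n → ℂ}
  {A : Fin n → ℝ × E n → ℂ} {p : ℝ × E n}

theorem IsTest.mul_left (h : IsTest W φ) (hW : IsOpen W) (hc : ContDiffOn ℝ ∞ c W) :
    IsTest W fun p => c p * φ p where
  smooth := contDiff_of_forall_mem_tsupport fun _ hp =>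
    (hc.contDiffAt (hW.mem_nhds (h.supp (tsupport_mul_subset_right hp)))).mul h.smooth.contDiffAt
  compact := h.compact.mul_left
  supp := tsupport_mul_subset_right.trans h.supp

theorem IsTest.add (h₁ : IsTest W φ) (h₂ : IsTest W ψ) : IsTest W fun p => φ p + ψ p :=
  ⟨h₁.smooth.add h₂.smooth, h₁.compact.add h₂.compact,
    (tsupport_add φ ψ).trans (union_subset h₁.supp h₂.supp)⟩

theorem IsTest.neg (h : IsTest W φ) : IsTest W fun p => -φ p :=
  ⟨h.smooth.neg, h.compact.neg, (closure_mono (Function.support_fun_neg φ).le).trans h.supp⟩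

theorem IsTest.sum {ι : Type*} (s : Finset ι) {φ : ι → ℝ × E n → ℂ} (h : ∀ i, IsTest W (φ i)) :
    IsTest W fun p => ∑ i ∈ s, φ i p := by
  classical
  induction s using Finset.induction_on with
  | empty =>
    exact ⟨by simpa using contDiff_const, by simp [HasCompactSupport, tsupport], by simp [tsupport]⟩
  | insert i s hi ih => simpa only [Finset.sum_insert hi] using (h i).add ih

theorem IsTest.fderiv_apply (h : IsTest W φ) (v : ℝ × E n) : IsTest W fun p => fderiv ℝ φ p v :=
  ⟨(h.smooth.fderiv_right (m := ∞) (by simp)).clm_apply contDiff_const,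
    h.compact.fderiv_apply (𝕜 := ℝ) v, (tsupport_fderiv_apply_subset ℝ v).trans h.supp⟩

theorem IsTest.vfTranspose (h : IsTest W φ) (hW : IsOpen W) (ha : ContDiffOn ℝ ∞ a W)
    (hA : ∀ j, ContDiffOn ℝ ∞ (A j) W) : IsTest W (vfTranspose a A φ) := by
  simpa only [← sub_eq_add_neg] using! ((h.mul_left hW ha).fderiv_apply (1, 0)).neg.add
    (IsTest.sum Finset.univ fun j =>
      (h.mul_left hW (hA j)).fderiv_apply (0, EuclideanSpace.single j 1)).neg

theorem IsTest.vfTranspose_add_mul (h : IsTest W φ) (hW : IsOpen W) (ha : ContDiffOn ℝ ∞ a W)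
    (hA : ∀ j, ContDiffOn ℝ ∞ (A j) W) (hb : ContDiffOn ℝ ∞ b W) :
    IsTest W fun p => Gluing.vfTranspose a A φ p + b p * φ p :=
  (h.vfTranspose hW ha hA).add (h.mul_left hW hb)

theorem IsTest.mul_time (h : IsTest W φ) {χ : ℝ → ℝ} (hχ : ContDiff ℝ ∞ χ) {t₀ : ℝ}
    (ht₀ : t₀ ∉ tsupport χ) :
    IsTest (W \ Prod.fst ⁻¹' {t₀}) fun p => (χ p.1 : ℂ) * φ p where
  smooth := (Complex.ofRealCLM.contDiff.comp (hχ.comp contDiff_fst)).mul h.smooth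
  compact := h.compact.mul_left
  supp p hp := by
    refine ⟨h.supp (tsupport_mul_subset_right hp), fun hpt => ht₀ ?_⟩
    have hp' : p ∈ tsupport fun q : ℝ × E n => χ q.1 :=
      closure_mono (fun q hq => by simpa using left_ne_zero_of_mul hq) hp
    exact (mem_preimage.1 hpt : p.1 = t₀) ▸ tsupport_comp_subset_preimage χ continuous_fst hp'

theorem IsTest.indicator (h : IsTest (U ∪ V) φ) (hU : IsOpen U) (hV : IsOpen V)
    (hUV : Disjoint U V) : IsTest U (U.indicator φ) := by
  have hle : tsupport (U.indicator φ) ⊆ tsupport φ := closure_mono (by simp)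
  have hsupp : tsupport (U.indicator φ) ⊆ U := fun p hp =>
    (h.supp (hle hp)).resolve_right fun hpV => notMem_tsupport_iff_eventuallyEq.2
      (by filter_upwards [hV.mem_nhds hpV] with q hq
          exact indicator_of_notMem (hUV.notMem_of_mem_right hq) φ) hp
  refine ⟨contDiff_of_forall_mem_tsupport fun p hp => ?_,
    h.compact.of_isClosed_subset (isClosed_tsupport _) hle, hsupp⟩
  refine h.smooth.contDiffAt.congr_of_eventuallyEq ?_
  filter_upwards [hU.mem_nhds (hsupp hp)] with q hq using indicator_of_mem hq φ

theorem IsTest.eq_zero (h : IsTest W φ) (hp : p ∉ W) : φ p = 0 :=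
  image_eq_zero_of_notMem_tsupport fun hp' => hp (h.supp hp')

theorem IsTest.integrable (h : IsTest W φ) : Integrable φ :=
  h.smooth.continuous.integrable_of_hasCompactSupport h.compact

theorem IsTest.integrable_mul (h : IsTest W φ) {u : ℝ × E n → ℂ} (hu : LocallyIntegrableOn u W) :
    Integrable fun p => u p * φ p := by
  obtain ⟨C, hC⟩ := h.compact.exists_bound_of_continuous h.smooth.continuous
  rw [← integrableOn_iff_integrable_of_support_subset
    (s := tsupport φ) fun p hp => subset_tsupport φ (right_ne_zero_of_mul hp)]
  exact (hu.integrableOn_compact_subset h.supp h.compact).mul_bdd (c := C)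
    h.smooth.continuous.aestronglyMeasurable (Eventually.of_forall hC)

theorem vfTranspose_congr (h : φ =ᶠ[𝓝 p] ψ) : vfTranspose a A φ p = vfTranspose a A ψ p := by
  have hmul (c : ℝ × E n → ℂ) : (fun q => c q * φ q) =ᶠ[𝓝 p] fun q => c q * ψ q :=
    h.mono fun q hq => by simp only [hq]
  simp only [vfTranspose, dt, dx, (hmul _).fderiv_eq]

theorem IsTest.vfTranspose_eq_zero (h : IsTest W φ) (hp : p ∉ W) :
    Gluing.vfTranspose a A φ p = 0 := by
  rw [vfTranspose_congr (notMem_tsupport_iff_eventuallyEq.1 fun hp' => hp (h.supp hp'))]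
  simp [Gluing.vfTranspose, dt, dx]

theorem isDistSol_iff {f u : ℝ × E n → ℂ} : IsDistSol W a A b f u ↔ ∀ φ, IsTest W φ →
    ∫ p, u p * (Gluing.vfTranspose a A φ p + b p * φ p) = ∫ p, f p * φ p := by
  refine forall₂_congr fun φ hφ => ?_
  rw [setIntegral_eq_integral_of_forall_compl_eq_zero,
    setIntegral_eq_integral_of_forall_compl_eq_zero]
  · exact fun p hp => by rw [hφ.eq_zero hp, mul_zero]
  · exact fun p hp => by rw [hφ.vfTranspose_eq_zero hp, hφ.eq_zero hp]; simp

theorem IsTest.integral_fderiv (h : IsTest W φ) (v : ℝ × E n) : ∫ p, fderiv ℝ φ p v = 0 := by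
  have : (volume : Measure (ℝ × E n)).IsAddHaarMeasure :=
    inferInstanceAs ((volume : Measure ℝ).prod (volume : Measure (E n))).IsAddHaarMeasure
  simpa using integral_mul_fderiv_eq_neg_fderiv_mul_of_integrable
    (μ := (volume : Measure (ℝ × E n))) (f := fun _ => (1 : ℂ)) (g := φ) (v := v) (by simp)
    (by simpa using (h.fderiv_apply v).integrable) (by simpa using h.integrable)
    (fun _ _ => differentiableAt_const _) (fun p _ => h.smooth.differentiable (by simp) p)

theorem IsTest.integral_vfTranspose (h : IsTest W φ) (hW : IsOpen W) (ha : ContDiffOn ℝ ∞ a W)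
    (hA : ∀ j, ContDiffOn ℝ ∞ (A j) W) : ∫ p, Gluing.vfTranspose a A φ p = 0 := by
  have hAφ (j) := h.mul_left hW (hA j)
  simp only [Gluing.vfTranspose, dt, dx]
  rw [integral_sub ((h.mul_left hW ha).fderiv_apply _).neg.integrable
      (IsTest.sum Finset.univ fun j => (hAφ j).fderiv_apply _).integrable,
    integral_neg, integral_finsetSum _ fun j _ => ((hAφ j).fderiv_apply _).integrable,
    (h.mul_left hW ha).integral_fderiv]
  simp [fun j => (hAφ j).integral_fderiv]

theorem vfTranspose_mul (hc : DifferentiableAt ℝ c p)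
    (ha : DifferentiableAt ℝ (fun q => a q * φ q) p)
    (hA : ∀ j, DifferentiableAt ℝ (fun q => A j q * φ q) p) :
    vfTranspose a A (fun q => c q * φ q) p =
      c p * vfTranspose a A φ p - vf a A c p * φ p := by
  have hfderiv {g : ℝ × E n → ℂ} (hg : DifferentiableAt ℝ (fun q => g q * φ q) p) (v : ℝ × E n) :
      fderiv ℝ (fun q => g q * (c q * φ q)) p v =
        c p * fderiv ℝ (fun q => g q * φ q) p v + g p * φ p * fderiv ℝ c p v := by
    simp only [mul_left_comm _ (c _), fderiv_fun_mul hc hg]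
    simp
  simp only [vfTranspose, vf, dt, dx, hfderiv ha, fun j => hfderiv (hA j),
    Finset.sum_add_distrib, ← Finset.mul_sum, add_mul, Finset.sum_mul]
  simp only [mul_right_comm _ (φ p)]
  ring

theorem IsTest.vfTranspose_mul_time (h : IsTest W φ) (hW : IsOpen W) (ha : ContDiffOn ℝ ∞ a W)
    (hA : ∀ j, ContDiffOn ℝ ∞ (A j) W) {χ : ℝ → ℝ} (hχ : ContDiff ℝ ∞ χ) (p : ℝ × E n) :
    Gluing.vfTranspose a A (fun q => (χ q.1 : ℂ) * φ q) p =
      χ p.1 * Gluing.vfTranspose a A φ p - deriv χ p.1 * (a p * φ p) := by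
  have hdiff : Differentiable ℝ χ := hχ.differentiable (by simp)
  have hχ' : HasFDerivAt (fun q : ℝ × E n => (χ q.1 : ℂ)) _ p :=
    Complex.ofRealCLM.hasFDerivAt.comp p ((hdiff p.1).hasDerivAt.hasFDerivAt.comp p hasFDerivAt_fst)
  rw [vfTranspose_mul hχ'.differentiableAt ((h.mul_left hW ha).smooth.differentiable (by simp) p)
    fun j => (h.mul_left hW (hA j)).smooth.differentiable (by simp) p]
  simp only [vf, dt, hχ'.fderiv, ContinuousLinearMap.comp_apply, ContinuousLinearMap.coe_fst',
    ContinuousLinearMap.toSpanSingleton_apply, smul_eq_mul, one_mul, Complex.ofRealCLM_apply, dx,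
    zero_mul, Complex.ofReal_zero, mul_zero, Finset.sum_const_zero, add_zero, sub_right_inj]
  ring

end Tests

section Functions

variable {n : ℕ} {U V W : Set (ℝ × E n)} {a b f u v : ℝ × E n → ℂ} {A : Fin n → ℝ × E n → ℂ}

theorem isDistSol_of_classical (hW : IsOpen W) (ha : ContDiffOn ℝ ∞ a W)
    (hA : ∀ j, ContDiffOn ℝ ∞ (A j) W) (hb : ContDiffOn ℝ ∞ b W) (hf : ContDiffOn ℝ ∞ f W)
    (hu : ContDiffOn ℝ ∞ u W) (h : ∀ p ∈ W, vf a A u p + b p * u p = f p) :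
    IsDistSol W a A b f u := by
  refine isDistSol_iff.2 fun φ hφ => ?_
  have hT := hφ.vfTranspose_add_mul hW ha hA hb
  have huφ := hφ.mul_left hW hu
  rw [← sub_eq_zero, ← integral_sub (hT.mul_left hW hu).integrable (hφ.mul_left hW hf).integrable,
    ← huφ.integral_vfTranspose hW ha hA]
  congr with p
  by_cases hp : p ∈ W
  · have hdiff {c : ℝ × E n → ℂ} (hc : ContDiffOn ℝ ∞ c W) :
        DifferentiableAt ℝ (fun q => c q * φ q) p :=
      (hφ.mul_left hW hc).smooth.differentiable (by simp) p
    rw [vfTranspose_mul ((hu.contDiffAt (hW.mem_nhds hp)).differentiableAt (by simp))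
      (hdiff ha) fun j => hdiff (hA j), ← h p hp]
    ring
  · rw [hT.eq_zero hp, hφ.eq_zero hp, huφ.vfTranspose_eq_zero hp]
    simp

theorem IsDistSol.congr (h : IsDistSol W a A b f u) (hW : MeasurableSet W) (huv : EqOn u v W) :
    IsDistSol W a A b f v := fun φ hφ => by
  rw [← h φ hφ]
  exact setIntegral_congr_fun hW fun p hp => by simp only [huv hp]

theorem IsDistSol.union (hU : IsOpen U) (hV : IsOpen V) (hUV : Disjoint U V)
    (ha : ContDiffOn ℝ ∞ a (U ∪ V)) (hA : ∀ j, ContDiffOn ℝ ∞ (A j) (U ∪ V))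
    (hb : ContDiffOn ℝ ∞ b (U ∪ V)) (hf : LocallyIntegrableOn f (U ∪ V))
    (hu : LocallyIntegrableOn u (U ∪ V)) (h₁ : IsDistSol U a A b f u)
    (h₂ : IsDistSol V a A b f u) : IsDistSol (U ∪ V) a A b f u := by
  intro φ hφ
  have hT := hφ.vfTranspose_add_mul (hU.union hV) ha hA hb
  have hpiece {S : Set (ℝ × E n)} (hS : IsOpen S) (hφS : IsTest S (S.indicator φ))
      (h : IsDistSol S a A b f u) :
      ∫ p in S, u p * (vfTranspose a A φ p + b p * φ p) = ∫ p in S, f p * φ p := by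
    calc ∫ p in S, u p * (vfTranspose a A φ p + b p * φ p)
        = ∫ p in S, u p * (vfTranspose a A (S.indicator φ) p + b p * S.indicator φ p) := by
          refine setIntegral_congr_fun hS.measurableSet fun p hp => ?_
          rw [vfTranspose_congr (φ := φ) (ψ := S.indicator φ), indicator_of_mem hp]
          filter_upwards [hS.mem_nhds hp] with q hq using (indicator_of_mem hq φ).symm
      _ = ∫ p in S, f p * S.indicator φ p := h _ hφS
      _ = ∫ p in S, f p * φ p := setIntegral_congr_fun hS.measurableSet fun p hp => by
          simp only [indicator_of_mem hp]
  rw [setIntegral_union hUV hV.measurableSet (hT.integrable_mul hu).integrableOn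
      (hT.integrable_mul hu).integrableOn,
    setIntegral_union hUV hV.measurableSet (hφ.integrable_mul hf).integrableOn
      (hφ.integrable_mul hf).integrableOn,
    hpiece hU (hφ.indicator hU hV hUV) h₁,
    hpiece hV ((union_comm U V ▸ hφ).indicator hV hU hUV.symm) h₂]

theorem IsDistSol.of_sdiff_time (hW : IsOpen W) (ha : ContDiffOn ℝ ∞ a W)
    (hA : ∀ j, ContDiffOn ℝ ∞ (A j) W) (hb : ContDiffOn ℝ ∞ b W) (hf : LocallyIntegrableOn f W)
    (hu : LocallyIntegrableOn u W) {t₀ : ℝ} (h : IsDistSol (W \ Prod.fst ⁻¹' {t₀}) a A b f u)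
    (hflux : ∀ φ, IsTest W φ →
      Tendsto (fun t => ∫ x, a (t, x) * u (t, x) * φ (t, x)) (𝓝[≠] t₀) (𝓝 0)) :
    IsDistSol W a A b f u := by
  refine isDistSol_iff.2 fun φ hφ => ?_
  have hP := (hφ.vfTranspose_add_mul hW ha hA hb).integrable_mul hu
  have hR := hφ.integrable_mul hf
  have hS : Integrable fun p => a p * u p * φ p := by
    simpa only [mul_left_comm, mul_assoc] using (hφ.mul_left hW ha).integrable_mul hu
  rw [Measure.volume_eq_prod, integral_prod _ hP, integral_prod _ hR]
  refine integral_eq_of_forall_cutoff (t₀ := t₀) hP.integral_prod_left hR.integral_prod_left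
    hS.integral_prod_left (hflux φ hφ) fun χ hχ hχt₀ => ?_
  have hχφ := isDistSol_iff.1 h _ (hφ.mul_time hχ hχt₀)
  have hχW : ContDiffOn ℝ ∞ (fun p : ℝ × E n => (χ p.1 : ℂ)) W :=
    (Complex.ofRealCLM.contDiff.comp (hχ.comp contDiff_fst)).contDiffOn
  have hP' : Integrable fun p =>
      u p * (vfTranspose a A (fun q => χ q.1 * φ q) p + b p * (χ p.1 * φ p)) :=
    ((hφ.mul_left hW hχW).vfTranspose_add_mul hW ha hA hb).integrable_mul hu
  have hR' : Integrable fun p => f p * (χ p.1 * φ p) := (hφ.mul_left hW hχW).integrable_mul hf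
  rw [Measure.volume_eq_prod, integral_prod _ hP', integral_prod _ hR'] at hχφ
  simp only [mul_left_comm (f _)] at hχφ
  simp only [← integral_smul, Complex.real_smul]
  rw [← hχφ]
  refine integral_congr_ae ?_
  filter_upwards [hP.prod_right_ae, hS.prod_right_ae] with t hPt hSt
  rw [← integral_sub (hPt.const_mul _) (hSt.const_mul _)]
  congr with x
  rw [hφ.vfTranspose_mul_time hW ha hA hχ]
  ring

end Functions

section Glue

variable {n : ℕ} {δ : ℝ} {K Ω : Set (E n)} {up um : ℝ × E n → ℂ}

theorem Ioo_sdiff_zero (δ : ℝ) : Ioo (-δ) δ \ {0} = Ioo 0 δ ∪ Ioo (-δ) 0 := by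
  ext t
  simp only [Set.mem_sdiff, mem_union, mem_Ioo, mem_singleton_iff]
  grind

theorem disjoint_Ioo_zero (δ : ℝ) : Disjoint (Ioo 0 δ) (Ioo (-δ) 0) :=
  disjoint_left.2 fun _ h h' => lt_asymm h.1 h'.2

theorem cyl_sdiff_zero (δ : ℝ) (K : Set (E n)) :
    cyl (Ioo (-δ) δ) K \ Prod.fst ⁻¹' {0} = cyl (Ioo 0 δ) K ∪ cyl (Ioo (-δ) 0) K := by
  rw [cyl, cyl, cyl, ← union_prod, ← Ioo_sdiff_zero]
  ext p
  simp only [Set.mem_sdiff, mem_prod, mem_preimage]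
  tauto

theorem ae_fst_ne (t₀ : ℝ) : ∀ᵐ p : ℝ × E n, p.1 ≠ t₀ :=
  Measure.quasiMeasurePreserving_fst.ae (Measure.ae_ne volume t₀)

theorem glue_eqOn_pos : EqOn (glue up um) up (cyl (Ioo 0 δ) K) := fun p hp => by
  simp [glue, show 0 < p.1 from hp.1.1]

theorem glue_eqOn_neg : EqOn (glue up um) um (cyl (Ioo (-δ) 0) K) := fun p hp => by
  simp [glue, show p.1 < 0 from hp.1.2, (show p.1 < 0 from hp.1.2).le]

theorem integrableOn_glue (hK : MeasurableSet K) (hp : IntegrableOn up (cyl (Ioo 0 δ) K))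
    (hm : IntegrableOn um (cyl (Ioo (-δ) 0) K)) :
    IntegrableOn (glue up um) (cyl (Ioo (-δ) δ) K) := by
  have hunion := (hp.congr_fun glue_eqOn_pos.symm (measurableSet_Ioo.prod hK)).union
    (hm.congr_fun glue_eqOn_neg.symm (measurableSet_Ioo.prod hK))
  rw [← cyl_sdiff_zero] at hunion
  refine hunion.congr_set_ae ?_
  filter_upwards [ae_fst_ne (n := n) 0] with p hp
  exact propext ⟨fun h => ⟨h, hp⟩, fun h => h.1⟩

theorem locallyIntegrableOn_cyl {J : Set ℝ} (hJ : IsOpen J) (hΩ : IsOpen Ω) {u : ℝ × E n → ℂ}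
    (hu : ∀ K : Set (E n), IsCompact K → K ⊆ Ω → IntegrableOn u (cyl J K)) :
    LocallyIntegrableOn u (cyl J Ω) := by
  intro p hp
  obtain ⟨K, hK, hpK, hKΩ⟩ := exists_compact_subset hΩ hp.2
  exact ⟨cyl J K, mem_nhdsWithin_of_mem_nhds
    (prod_mem_nhds (hJ.mem_nhds hp.1) (mem_interior_iff_mem_nhds.1 hpK)), hu K hK hKΩ⟩

theorem tendsto_nhdsNE_of_sides {Y : Type*} {l : Filter Y} {t₀ : ℝ} {g gp gm : ℝ → Y}
    (hp : ∀ t, t₀ < t → g t = gp t) (hm : ∀ t, t < t₀ → g t = gm t)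
    (hgp : Tendsto gp (𝓝[>] t₀) l) (hgm : Tendsto gm (𝓝[<] t₀) l) :
    Tendsto g (𝓝[≠] t₀) l := by
  rw [← nhdsLT_sup_nhdsGT, tendsto_sup]
  exact ⟨hgm.congr' (eventually_mem_nhdsWithin.mono fun t ht => (hm t ht).symm),
    hgp.congr' (eventually_mem_nhdsWithin.mono fun t ht => (hp t ht).symm)⟩

theorem IsDistSol.glue (hΩ : IsOpen Ω) {a b f : ℝ × E n → ℂ} {A : Fin n → ℝ × E n → ℂ}
    (ha : ContDiffOn ℝ ∞ a (cyl (Ioo (-δ) δ) Ω))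
    (hA : ∀ j, ContDiffOn ℝ ∞ (A j) (cyl (Ioo (-δ) δ) Ω))
    (hb : ContDiffOn ℝ ∞ b (cyl (Ioo (-δ) δ) Ω))
    (hf : LocallyIntegrableOn f (cyl (Ioo (-δ) δ) Ω))
    (hu : LocallyIntegrableOn (glue up um) (cyl (Ioo (-δ) δ) Ω))
    (hp : IsDistSol (cyl (Ioo 0 δ) Ω) a A b f up) (hm : IsDistSol (cyl (Ioo (-δ) 0) Ω) a A b f um)
    (hfluxp : ∀ φ, IsTest (cyl (Ioo (-δ) δ) Ω) φ →
      Tendsto (fun t => ∫ x, a (t, x) * up (t, x) * φ (t, x)) (𝓝[>] 0) (𝓝 0))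
    (hfluxm : ∀ φ, IsTest (cyl (Ioo (-δ) δ) Ω) φ →
      Tendsto (fun t => ∫ x, a (t, x) * um (t, x) * φ (t, x)) (𝓝[<] 0) (𝓝 0)) :
    IsDistSol (cyl (Ioo (-δ) δ) Ω) a A b f (Gluing.glue up um) := by
  have hopen : IsOpen (cyl (Ioo 0 δ) Ω) := isOpen_Ioo.prod hΩ
  have hopen' : IsOpen (cyl (Ioo (-δ) 0) Ω) := isOpen_Ioo.prod hΩ
  have hdisj : Disjoint (cyl (Ioo 0 δ) Ω) (cyl (Ioo (-δ) 0) Ω) :=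
    (disjoint_Ioo_zero δ).set_prod_left _ _
  refine IsDistSol.of_sdiff_time (isOpen_Ioo.prod hΩ) ha hA hb hf hu (t₀ := 0) ?_ fun φ hφ =>
    tendsto_nhdsNE_of_sides (fun t ht => ?_) (fun t ht => ?_) (hfluxp φ hφ) (hfluxm φ hφ)
  · have hsub := (cyl_sdiff_zero δ Ω).ge.trans sdiff_subset
    rw [cyl_sdiff_zero]
    exact (hp.congr hopen.measurableSet glue_eqOn_pos.symm).union hopen hopen' hdisj
      (ha.mono hsub) (fun j => (hA j).mono hsub) (hb.mono hsub) (hf.mono_set hsub)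
      (hu.mono_set hsub) (hm.congr hopen'.measurableSet glue_eqOn_neg.symm)
  · simp only [Gluing.glue, if_pos ht]
  · simp only [Gluing.glue, if_neg (not_lt.2 ht.le), if_pos ht]

end Glue

section SchwartzFamily

theorem isVonNBounded_range_schwartz_iff {𝕜 ι V F : Type*} [NontriviallyNormedField 𝕜]
    [NormedAddCommGroup V] [NormedSpace ℝ V] [NormedAddCommGroup F] [NormedSpace ℝ F]
    [NormedSpace 𝕜 F] [SMulCommClass ℝ 𝕜 F] {Ψ : ι → 𝓢(V, F)} :
    Bornology.IsVonNBounded 𝕜 (range Ψ) ↔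
      ∀ k m : ℕ, ∃ C : ℝ, ∀ i x, ‖x‖ ^ k * ‖iteratedFDeriv ℝ m (Ψ i) x‖ ≤ C := by
  simp only [(schwartz_withSeminorms 𝕜 V F).isVonNBounded_iff_seminorm_bounded, Prod.forall,
    forall_mem_range]
  refine forall₂_congr fun k m => ⟨fun ⟨C, _, hC⟩ => ⟨C, fun i x => ?_⟩, fun ⟨C, hC⟩ =>
    ⟨max C 0 + 1, by positivity, fun i => ?_⟩⟩
  · exact (SchwartzMap.le_seminorm 𝕜 k m (Ψ i) x).trans (hC i).le
  · exact (SchwartzMap.seminorm_le_bound 𝕜 k m (Ψ i) (le_max_right C 0)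
      fun x => (hC i x).trans (le_max_left C 0)).trans_lt (lt_add_one _)

theorem stronglyMeasurable_fourierInv {X V F : Type*} [MeasurableSpace X] [NormedAddCommGroup V]
    [InnerProductSpace ℝ V] [FiniteDimensional ℝ V] [MeasurableSpace V] [BorelSpace V]
    [NormedAddCommGroup F] [NormedSpace ℂ F] {h : X × V → V → F}
    (hh : StronglyMeasurable (Function.uncurry h)) :
    StronglyMeasurable fun p : X × V => 𝓕⁻ (h p) p.2 := by
  simp only [Real.fourierInv_eq']
  refine StronglyMeasurable.integral_prod_right ?_
  exact Measurable.stronglyMeasurable (by fun_prop) |>.smul hh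

variable {n : ℕ} {I : Set ℝ} {Ψ : ℝ → 𝓢(E n, ℂ)}

/-- A curve of Schwartz functions against which locally integrable curves of distributions on the
time set `I` can be integrated: it is bounded in the Schwartz space, jointly measurable in `(t, x)`,
and vanishes for `t` outside a compact subset of `I`. -/
structure IsTestCurve (I : Set ℝ) (Ψ : ℝ → 𝓢(E n, ℂ)) : Prop where
  isVonNBounded_range : Bornology.IsVonNBounded ℂ (range Ψ)
  stronglyMeasurable : StronglyMeasurable fun p : ℝ × E n => Ψ p.1 p.2
  exists_compact : ∃ J, IsCompact J ∧ J ⊆ I ∧ ∀ t ∉ J, Ψ t = 0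

theorem IsTestCurve.eq_zero (h : IsTestCurve I Ψ) {t : ℝ} (ht : t ∉ I) : Ψ t = 0 :=
  let ⟨_, _, hJI, hJ0⟩ := h.exists_compact
  hJ0 t fun htJ => ht (hJI htJ)

theorem IsTestCurve.comp_clm (h : IsTestCurve I Ψ) (T : 𝓢(E n, ℂ) →L[ℂ] 𝓢(E n, ℂ))
    (hT : StronglyMeasurable fun p : ℝ × E n => T (Ψ p.1) p.2) :
    IsTestCurve I fun t => T (Ψ t) where
  isVonNBounded_range := by
    rw [range_comp' T Ψ]
    exact h.isVonNBounded_range.image T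
  stronglyMeasurable := hT
  exists_compact :=
    let ⟨J, hJ, hJI, hJ0⟩ := h.exists_compact
    ⟨J, hJ, hJI, fun t ht => by rw [hJ0 t ht, map_zero]⟩

theorem IsTestCurve.smulLeftCLM (h : IsTestCurve I Ψ) {c : E n → ℂ} (hc : c.HasTemperateGrowth) :
    IsTestCurve I fun t => SchwartzMap.smulLeftCLM ℂ c (Ψ t) := by
  refine h.comp_clm (SchwartzMap.smulLeftCLM ℂ c) ?_
  simp only [SchwartzMap.smulLeftCLM_apply_apply hc]
  exact (hc.1.continuous.comp continuous_snd).stronglyMeasurable.smul h.stronglyMeasurable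

theorem IsTestCurve.stronglyMeasurable_fourierInv (h : IsTestCurve I Ψ) :
    StronglyMeasurable fun p : ℝ × E n => 𝓕⁻ (Ψ p.1) p.2 := by
  simp only [SchwartzMap.fourierInv_coe]
  exact Gluing.stronglyMeasurable_fourierInv (h := fun p : ℝ × E n => ⇑(Ψ p.1))
    (h.stronglyMeasurable.comp_measurable
      (g := fun q : (ℝ × E n) × E n => (q.1.1, q.2)) (by fun_prop))

theorem IsTestCurve.fourierInv (h : IsTestCurve I Ψ) : IsTestCurve I fun t => 𝓕⁻ (Ψ t) :=
  h.comp_clm (FourierTransform.fourierInvCLM ℂ 𝓢(E n, ℂ)) h.stronglyMeasurable_fourierInv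

theorem IsTestCurve.fourier (h : IsTestCurve I Ψ) : IsTestCurve I fun t => 𝓕 (Ψ t) := by
  refine h.comp_clm (FourierTransform.fourierCLM ℂ 𝓢(E n, ℂ)) ?_
  have hneg : StronglyMeasurable fun p : ℝ × E n => 𝓕⁻ (Ψ p.1) (-p.2) :=
    h.stronglyMeasurable_fourierInv.comp_measurable (g := fun p : ℝ × E n => (p.1, -p.2))
      (by fun_prop)
  simp only [SchwartzMap.fourierInv_coe, Real.fourierInv_eq_fourier_neg, neg_neg,
    ← SchwartzMap.fourier_coe] at hneg
  exact hneg

end SchwartzFamily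

section TestSlice

variable {n : ℕ} {I : Set ℝ} {W : Set (ℝ × E n)} {φ : ℝ × E n → ℂ}

theorem IsTest.contDiff_slice (h : IsTest W φ) (t : ℝ) : ContDiff ℝ ∞ fun x => φ (t, x) :=
  h.smooth.comp (contDiff_const.prodMk contDiff_id)

/-- The slice `φ(t, ·)` of a test function, as a Schwartz function. -/
def IsTest.slice (h : IsTest W φ) (t : ℝ) : 𝓢(E n, ℂ) :=
  HasCompactSupport.toSchwartzMap (f := fun x => φ (t, x))
    (HasCompactSupport.intro (h.compact.isCompact.image continuous_snd) fun _ hx =>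
      image_eq_zero_of_notMem_tsupport fun hp => hx ⟨_, hp, rfl⟩)
    (h.contDiff_slice t)

theorem IsTest.exists_bound_slice (h : IsTest W φ) (k m : ℕ) :
    ∃ C : ℝ, ∀ t x, ‖x‖ ^ k * ‖iteratedFDeriv ℝ m (fun x => φ (t, x)) x‖ ≤ C := by
  let ι : E n →L[ℝ] ℝ × E n := ContinuousLinearMap.inr ℝ ℝ (E n)
  have hc : Continuous fun p : ℝ × E n => ‖p.2‖ ^ k * ‖iteratedFDeriv ℝ m φ p‖ :=
    (continuous_snd.norm.pow k).mul
      (h.smooth.continuous_iteratedFDeriv (by exact_mod_cast le_top)).norm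
  obtain ⟨C, hC⟩ :=
    ((h.compact.iteratedFDeriv (𝕜 := ℝ) m).norm.mul_left).exists_bound_of_continuous hc
  refine ⟨C * ‖ι‖ ^ m, fun t x => ?_⟩
  have hslice : (fun x => φ (t, x)) = (fun p => φ ((t, 0) + p)) ∘ ι := by
    ext x
    simp [ι]
  have hsm : ContDiff ℝ m (fun p => φ ((t, 0) + p)) :=
    (h.smooth.comp (contDiff_const.add contDiff_id)).of_le (by exact_mod_cast le_top)
  rw [hslice, ι.iteratedFDeriv_comp_right hsm x le_rfl, iteratedFDeriv_comp_add_left]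
  calc ‖x‖ ^ k * ‖(iteratedFDeriv ℝ m φ ((t, 0) + ι x)).compContinuousLinearMap fun _ => ι‖
      ≤ ‖x‖ ^ k * (‖iteratedFDeriv ℝ m φ ((t, 0) + ι x)‖ * ∏ _ : Fin m, ‖ι‖) := by
        gcongr
        exact ContinuousMultilinearMap.norm_compContinuousLinearMap_le _ _
    _ = ‖x‖ ^ k * ‖iteratedFDeriv ℝ m φ (t, x)‖ * ‖ι‖ ^ m := by simp [ι, mul_assoc]
    _ ≤ C * ‖ι‖ ^ m := by
        gcongr
        simpa using hC (t, x)

theorem IsTest.exists_compact_time (h : IsTest (cyl I univ) φ) :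
    ∃ J : Set ℝ, IsCompact J ∧ J ⊆ I ∧ ∀ t ∉ J, ∀ x, φ (t, x) = 0 :=
  ⟨Prod.fst '' tsupport φ, h.compact.isCompact.image continuous_fst,
    image_subset_iff.2 fun _ hp => (h.supp hp).1,
    fun _ ht _ => image_eq_zero_of_notMem_tsupport fun hp => ht ⟨_, hp, rfl⟩⟩

theorem IsTest.isTestCurve_slice (h : IsTest (cyl I univ) φ) : IsTestCurve I h.slice where
  isVonNBounded_range := isVonNBounded_range_schwartz_iff.2 h.exists_bound_slice
  stronglyMeasurable := h.smooth.continuous.stronglyMeasurable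
  exists_compact :=
    let ⟨J, hJ, hJI, hJ0⟩ := h.exists_compact_time
    ⟨J, hJ, hJI, fun t ht => by ext x; exact hJ0 t ht x⟩

end TestSlice

theorem aestronglyMeasurable_clm_apply₂ {𝕜 X U V W : Type*} [NontriviallyNormedField 𝕜]
    [MeasurableSpace X] [SeminormedAddCommGroup U] [NormedSpace 𝕜 U] [NormedAddCommGroup V]
    [NormedSpace 𝕜 V] [SecondCountableTopology V] [NormedAddCommGroup W] [NormedSpace 𝕜 W]
    {μ : Measure X} (B : U →L[𝕜] V →L[𝕜] W) {y : X → U} {g : X → V}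
    (hy : ∀ c, StronglyMeasurable fun x => B (y x) c) (hg : AEStronglyMeasurable g μ) :
    AEStronglyMeasurable (fun x => B (y x) (g x)) μ := by
  borelize V
  have hjoint : StronglyMeasurable (Function.uncurry fun c x => B (y x) c) :=
    stronglyMeasurable_uncurry_of_continuous_of_stronglyMeasurable
      (fun x => (B (y x)).continuous) hy
  exact hjoint.aestronglyMeasurable.comp_aemeasurable (hg.aemeasurable.prodMk aemeasurable_id)

section Pairing

variable {n : ℕ} {I : Set ℝ} {Ψ : ℝ → 𝓢(E n, ℂ)}

/-- The bilinear pairing `(v, w) ↦ ∫ v w` on `L²(ℝⁿ)`. -/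
def pairingL2 (n : ℕ) :
    Lp ℂ 2 (volume : Measure (E n)) →L[ℂ] Lp ℂ 2 (volume : Measure (E n)) →L[ℂ] ℂ :=
  (ContinuousLinearMap.lsmul ℂ ℂ).lpPairing volume 2 2

theorem pairingL2_toLp (ψ : 𝓢(E n, ℂ)) (g : Lp ℂ 2 (volume : Measure (E n))) :
    pairingL2 n (ψ.toLp 2) g = ∫ x, ψ x * g x := by
  rw [pairingL2, ContinuousLinearMap.lpPairing_eq_integral]
  refine integral_congr_ae ?_
  filter_upwards [ψ.coeFn_toLp 2 volume] with x hx
  rw [hx, ContinuousLinearMap.lsmul_apply, smul_eq_mul]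

theorem IsTestCurve.aestronglyMeasurable_pairingL2 (h : IsTestCurve I Ψ) {μ : Measure ℝ}
    {g : ℝ → Lp ℂ 2 (volume : Measure (E n))} (hg : AEStronglyMeasurable g μ) :
    AEStronglyMeasurable (fun t => pairingL2 n ((Ψ t).toLp 2) (g t)) μ := by
  have : Fact ((2 : ENNReal) ≠ ⊤) := ⟨ENNReal.ofNat_ne_top⟩
  refine aestronglyMeasurable_clm_apply₂ (pairingL2 n) (fun c => ?_) hg
  simp only [pairingL2_toLp]
  exact StronglyMeasurable.integral_prod_right (f := fun t x => Ψ t x * c x)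
    (h.stronglyMeasurable.mul ((Lp.stronglyMeasurable c).comp_measurable measurable_snd))

theorem IsTestCurve.exists_norm_toLp_le (h : IsTestCurve I Ψ) :
    ∃ C, ∀ t, ‖(Ψ t).toLp 2‖ ≤ C := by
  have hb := h.isVonNBounded_range.image (SchwartzMap.toLpCLM ℂ (E := E n) ℂ 2 volume)
  obtain ⟨C, hC⟩ := (NormedSpace.isVonNBounded_iff' ℂ).1 hb
  exact ⟨C, fun t => hC _ (mem_image_of_mem _ (mem_range_self t))⟩

theorem IsTestCurve.integrable_pairingL2 (h : IsTestCurve I Ψ) {J : Set ℝ} (hJ0 : ∀ t ∉ J, Ψ t = 0)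
    {g : ℝ → Lp ℂ 2 (volume : Measure (E n))} (hg : IntegrableOn g J) :
    Integrable fun t => pairingL2 n ((Ψ t).toLp 2) (g t) := by
  obtain ⟨C, hC⟩ := h.exists_norm_toLp_le
  refine IntegrableOn.integrable_of_forall_notMem_eq_zero (s := J) ?_ fun t ht => ?_
  · refine Integrable.mono' (hg.norm.const_mul (‖pairingL2 n‖ * C))
      (h.aestronglyMeasurable_pairingL2 hg.aestronglyMeasurable) (ae_of_all _ fun t => ?_)
    refine ((pairingL2 n).le_opNorm₂ _ _).trans ?_
    gcongr
    exact hC t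
  · rw [pairingL2_toLp, hJ0 t ht]
    simp

end Pairing

section Sobolev

variable {n : ℕ} {I : Set ℝ} {s₁ s₂ : ℝ} {u : ℝ → 𝓢'(E n, ℂ)} {Ψ : ℝ → 𝓢(E n, ℂ)}

/-- The weight `⟨x⟩^s`. -/
def weight (s : ℝ) (x : E n) : ℂ := (((1 + ‖x‖ ^ 2) ^ (s / 2) : ℝ) : ℂ)

/-- The Fourier multiplier of `⟨D⟩^s`, in Mathlib's normalization, where `D` is `2πξ`. -/
def freqWeight (s : ℝ) (ξ : E n) : ℂ :=
  (((1 + (2 * Real.pi) ^ 2 * ‖ξ‖ ^ 2) ^ (s / 2) : ℝ) : ℂ)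

theorem freqWeight_eq (s : ℝ) (ξ : E n) : freqWeight s ξ = weight s ((2 * Real.pi) • ξ) := by
  rw [freqWeight, weight, norm_smul, mul_pow _ ‖ξ‖, Real.norm_eq_abs, sq_abs]

theorem hasTemperateGrowth_weight (s : ℝ) : (weight (n := n) s).HasTemperateGrowth := by
  unfold weight
  fun_prop

theorem hasTemperateGrowth_freqWeight (s : ℝ) :
    (freqWeight (n := n) s).HasTemperateGrowth := by
  simp only [funext (freqWeight_eq (n := n) s)]
  exact (hasTemperateGrowth_weight s).comp
    ((2 * Real.pi) • ContinuousLinearMap.id ℝ (E n)).hasTemperateGrowth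

theorem weight_mul_weight_neg (s : ℝ) : weight (n := n) s * weight (-s) = fun _ => 1 := by
  ext x
  simp only [weight, Pi.mul_apply]
  rw [← Complex.ofReal_mul, ← Real.rpow_add (by positivity)]
  simp [neg_div]

theorem freqWeight_mul_freqWeight_neg (s : ℝ) :
    freqWeight (n := n) s * freqWeight (-s) = fun _ => 1 := by
  ext ξ
  rw [Pi.mul_apply, freqWeight_eq, freqWeight_eq]
  exact congrFun (weight_mul_weight_neg s) _

/-- The transpose of the inverse of `⟨x⟩^{s₂} ⟨D⟩^{s₁}`, on Schwartz functions. -/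
def sobolevInvTranspose (s₁ s₂ : ℝ) : 𝓢(E n, ℂ) →L[ℂ] 𝓢(E n, ℂ) :=
  SchwartzMap.smulLeftCLM ℂ (weight (-s₂)) ∘L FourierTransform.fourierCLM ℂ 𝓢(E n, ℂ) ∘L
    SchwartzMap.smulLeftCLM ℂ (freqWeight (-s₁)) ∘L FourierTransform.fourierInvCLM ℂ 𝓢(E n, ℂ)

theorem sobolevOp_apply_sobolevInvTranspose (v : 𝓢'(E n, ℂ)) (ψ : 𝓢(E n, ℂ)) :
    sobolevOp s₁ s₂ v (sobolevInvTranspose s₁ s₂ ψ) = v ψ := by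
  change TemperedDistribution.fourierMultiplierCLM ℂ (freqWeight (-s₁))
    (TemperedDistribution.smulLeftCLM ℂ (weight (-s₂))
      (TemperedDistribution.smulLeftCLM ℂ (weight s₂)
        (TemperedDistribution.fourierMultiplierCLM ℂ (freqWeight s₁) v))) ψ = v ψ
  rw [TemperedDistribution.smulLeftCLM_smulLeftCLM_apply (hasTemperateGrowth_weight _)
    (hasTemperateGrowth_weight _), weight_mul_weight_neg,
    TemperedDistribution.smulLeftCLM_const, one_smul,
    TemperedDistribution.fourierMultiplierCLM_fourierMultiplierCLM_apply
    (hasTemperateGrowth_freqWeight _) (hasTemperateGrowth_freqWeight _),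
    freqWeight_mul_freqWeight_neg, TemperedDistribution.fourierMultiplierCLM_const, one_smul,
    ContinuousLinearMap.id_apply]

theorem IsSobolevRep.apply_eq {v : 𝓢'(E n, ℂ)} {g : Lp ℂ 2 (volume : Measure (E n))}
    (h : IsSobolevRep s₁ s₂ v g) (ψ : 𝓢(E n, ℂ)) :
    v ψ = pairingL2 n ((sobolevInvTranspose s₁ s₂ ψ).toLp 2) g := by
  rw [pairingL2_toLp, ← sobolevOp_apply_sobolevInvTranspose, h, Lp.toTemperedDistribution_apply]
  simp only [smul_eq_mul]

theorem IsTestCurve.sobolevInvTranspose (h : IsTestCurve I Ψ) (s₁ s₂ : ℝ) :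
    IsTestCurve I fun t => sobolevInvTranspose s₁ s₂ (Ψ t) :=
  (h.fourierInv.smulLeftCLM (hasTemperateGrowth_freqWeight _)).fourier.smulLeftCLM
    (hasTemperateGrowth_weight _)

/-- `u ∈ L¹_loc(I : H^{s₁,s₂}(ℝⁿ))`. -/
def LocallyIntegrableSobolev (I : Set ℝ) (s₁ s₂ : ℝ) (u : ℝ → 𝓢'(E n, ℂ)) : Prop :=
  ∀ J : Set ℝ, IsCompact J → J ⊆ I → IntegrableSobolev J s₁ s₂ u

theorem IntegrableSobolev.locallyIntegrableSobolev (hu : IntegrableSobolev I s₁ s₂ u) :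
    LocallyIntegrableSobolev I s₁ s₂ u := fun _ _ hJI =>
  let ⟨g, hg, hug⟩ := hu
  ⟨g, hg.mono_set hJI, ae_restrict_of_ae_restrict_of_subset hJI hug⟩

theorem ContinuousSobolev.locallyIntegrableSobolev (hu : ContinuousSobolev I s₁ s₂ u) :
    LocallyIntegrableSobolev I s₁ s₂ u := fun _ hJ hJI =>
  let ⟨g, hg, hug⟩ := hu
  ⟨g, (hg.mono hJI).integrableOn_compact hJ,
    ae_restrict_of_forall_mem hJ.measurableSet fun t ht => hug t (hJI ht)⟩

theorem LocallyIntegrableSobolev.mono {I' : Set ℝ} (hu : LocallyIntegrableSobolev I s₁ s₂ u)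
    (h : I' ⊆ I) : LocallyIntegrableSobolev I' s₁ s₂ u :=
  fun J hJ hJI => hu J hJ (hJI.trans h)

theorem LocallyIntegrableSobolev.integrable_apply (hu : LocallyIntegrableSobolev I s₁ s₂ u)
    (hΨ : IsTestCurve I Ψ) : Integrable fun t => u t (Ψ t) := by
  obtain ⟨J, hJ, hJI, hJ0⟩ := hΨ.exists_compact
  obtain ⟨g, hg, hug⟩ := hu J hJ hJI
  have hpair := (hΨ.sobolevInvTranspose s₁ s₂).integrable_pairingL2
    (fun t ht => by rw [hJ0 t ht, map_zero]) hg
  refine IntegrableOn.integrable_of_forall_notMem_eq_zero (s := J)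
    (hpair.integrableOn.congr ?_) fun t ht => by rw [hJ0 t ht, map_zero]
  filter_upwards [hug] with t ht
  exact (ht.apply_eq (Ψ t)).symm

end Sobolev

section Amplitude

set_option maxSynthPendingDepth 3

universe w

variable {ι : Type*} {V F F' : Type w} [NormedAddCommGroup V] [InnerProductSpace ℝ V]
  [NormedAddCommGroup F] [NormedSpace ℝ F] [NormedAddCommGroup F'] [NormedSpace ℝ F']
  {g : V → V → F} {h : ι → V → V → F} {R : ℝ}

/-- A bounded family of symbols of order zero (with no gain from differentiation): each
`∂_x^k ∂_ξ^j` of `h i x ξ` is bounded, uniformly in `i`. -/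
structure IsSymbolFamily (h : ι → V → V → F) : Prop where
  smooth : ∀ i, ContDiff ℝ ∞ (Function.uncurry (h i))
  bound : ∀ k j : ℕ, ∃ C : ℝ, ∀ i x ξ,
    ‖iteratedFDeriv ℝ k (fun x' => iteratedFDeriv ℝ j (h i x') ξ) x‖ ≤ C

/-- A family of amplitudes for oscillatory integrals in `x`: symbols supported in `‖x‖ ≤ R`. -/
structure IsAmplitude (R : ℝ) (h : ι → V → V → F) : Prop extends IsSymbolFamily h where
  supp : ∀ i x ξ, R < ‖x‖ → h i x ξ = 0

theorem contDiff_left (hg : ContDiff ℝ ∞ (Function.uncurry g)) (ξ : V) :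
    ContDiff ℝ ∞ fun x => g x ξ :=
  hg.comp (contDiff_id.prodMk contDiff_const)

theorem contDiff_right (hg : ContDiff ℝ ∞ (Function.uncurry g)) (x : V) : ContDiff ℝ ∞ (g x) :=
  hg.comp (contDiff_const.prodMk contDiff_id)

theorem contDiff_uncurry_fderiv_right (hg : ContDiff ℝ ∞ (Function.uncurry g)) :
    ContDiff ℝ ∞ (Function.uncurry fun x ξ => fderiv ℝ (g x) ξ) :=
  ContDiff.fderiv (f := fun p : V × V => g p.1) (m := ∞)
    (hg.comp ((contDiff_fst.comp contDiff_fst).prodMk contDiff_snd)) contDiff_snd (by simp)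

theorem contDiff_uncurry_iteratedFDeriv_right {F : Type w} [NormedAddCommGroup F] [NormedSpace ℝ F]
    {g : V → V → F} (hg : ContDiff ℝ ∞ (Function.uncurry g)) (j : ℕ) :
    ContDiff ℝ ∞ (Function.uncurry fun x ξ => iteratedFDeriv ℝ j (g x) ξ) := by
  induction j generalizing F with
  | zero =>
    simp only [iteratedFDeriv_zero_eq_comp]
    exact (continuousMultilinearCurryFin0 ℝ V F).symm.contDiff.comp hg
  | succ j ih =>
    simp only [iteratedFDeriv_succ_eq_comp_right]
    exact (continuousMultilinearCurryRightEquiv' ℝ j V F).symm.contDiff.comp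
      (ih (contDiff_uncurry_fderiv_right hg))

theorem contDiff_iteratedFDeriv_right (hg : ContDiff ℝ ∞ (Function.uncurry g)) (j : ℕ) (ξ : V) :
    ContDiff ℝ ∞ fun x => iteratedFDeriv ℝ j (g x) ξ :=
  contDiff_left (contDiff_uncurry_iteratedFDeriv_right hg j) ξ

theorem IsSymbolFamily.add {h₁ h₂ : ι → V → V → F} (H₁ : IsSymbolFamily h₁)
    (H₂ : IsSymbolFamily h₂) : IsSymbolFamily fun i x ξ => h₁ i x ξ + h₂ i x ξ := by
  refine ⟨fun i => (H₁.smooth i).add (H₂.smooth i), fun k j => ?_⟩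
  obtain ⟨C₁, hC₁⟩ := H₁.bound k j
  obtain ⟨C₂, hC₂⟩ := H₂.bound k j
  refine ⟨C₁ + C₂, fun i x ξ => ?_⟩
  have hadd : (fun x' => iteratedFDeriv ℝ j (fun ξ => h₁ i x' ξ + h₂ i x' ξ) ξ) =
      (fun x' => iteratedFDeriv ℝ j (h₁ i x') ξ) + fun x' => iteratedFDeriv ℝ j (h₂ i x') ξ := by
    ext1 x'
    exact iteratedFDeriv_add_apply
      ((contDiff_right (H₁.smooth i) x').contDiffAt.of_le (by exact_mod_cast le_top))
      ((contDiff_right (H₂.smooth i) x').contDiffAt.of_le (by exact_mod_cast le_top))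
  rw [hadd, iteratedFDeriv_add_apply
    ((contDiff_iteratedFDeriv_right (H₁.smooth i) j ξ).contDiffAt.of_le (by exact_mod_cast le_top))
    ((contDiff_iteratedFDeriv_right (H₂.smooth i) j ξ).contDiffAt.of_le (by exact_mod_cast le_top))]
  exact norm_add_le_of_le (hC₁ i x ξ) (hC₂ i x ξ)

theorem IsSymbolFamily.fderiv_right (H : IsSymbolFamily h) :
    IsSymbolFamily fun i x ξ => fderiv ℝ (h i x) ξ := by
  refine ⟨fun i => contDiff_uncurry_fderiv_right (H.smooth i), fun k j => ?_⟩
  obtain ⟨C, hC⟩ := H.bound k (j + 1)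
  refine ⟨C, fun i x ξ => le_of_eq_of_le ?_ (hC i x ξ)⟩
  have hsucc : (fun x' => iteratedFDeriv ℝ (j + 1) (h i x') ξ) =
      (continuousMultilinearCurryRightEquiv' ℝ j V F).symm ∘
        fun x' => iteratedFDeriv ℝ j (fun ξ => fderiv ℝ (h i x') ξ) ξ := by
    ext1 x'
    rw [iteratedFDeriv_succ_eq_comp_right]
    rfl
  rw [hsucc, LinearIsometryEquiv.norm_iteratedFDeriv_comp_left]

theorem IsSymbolFamily.comp_smul_right (H : IsSymbolFamily h) (c : ℝ) :
    IsSymbolFamily fun i x ξ => h i x (c • ξ) := by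
  refine ⟨fun i => (H.smooth i).comp (contDiff_fst.prodMk (contDiff_snd.const_smul c)),
    fun k j => ?_⟩
  obtain ⟨C, hC⟩ := H.bound k j
  refine ⟨‖c ^ j‖ * C, fun i x ξ => ?_⟩
  have hsmul : (fun x' => iteratedFDeriv ℝ j (fun ξ => h i x' (c • ξ)) ξ) =
      c ^ j • fun x' => iteratedFDeriv ℝ j (h i x') (c • ξ) := by
    ext1 x'
    rw [iteratedFDeriv_comp_const_smul c
      ((contDiff_right (H.smooth i) x').of_le (by exact_mod_cast le_top))]
    rfl
  rw [hsmul, iteratedFDeriv_const_smul_apply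
    ((contDiff_iteratedFDeriv_right (H.smooth i) j _).contDiffAt.of_le
      (by exact_mod_cast le_top)), norm_smul]
  gcongr
  exact hC i x _

theorem iteratedFDeriv_iteratedFDeriv_eq_zero (hg : ∀ x ξ, R < ‖x‖ → g x ξ = 0) (k j : ℕ) {x : V}
    (hx : R < ‖x‖) (ξ : V) :
    iteratedFDeriv ℝ k (fun x' => iteratedFDeriv ℝ j (g x') ξ) x = 0 := by
  have hev : (fun x' => iteratedFDeriv ℝ j (g x') ξ) =ᶠ[𝓝 x] fun _ => 0 := by
    filter_upwards [continuous_norm.continuousAt.eventually (lt_mem_nhds hx)] with y hy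
    rw [funext fun ξ => hg y ξ hy]
    exact congrFun iteratedFDeriv_fun_zero ξ
  rw [(hev.iteratedFDeriv ℝ k).eq_of_nhds]
  exact congrFun iteratedFDeriv_fun_zero x

theorem IsSymbolFamily.isAmplitude_clm_apply (H : IsSymbolFamily h) {m : ι → V → F →L[ℝ] F'}
    (hm : ∀ i, ContDiff ℝ ∞ (m i))
    (hmb : ∀ k : ℕ, ∃ C : ℝ, ∀ i x, ‖x‖ ≤ R → ‖iteratedFDeriv ℝ k (m i) x‖ ≤ C)
    (hs : ∀ i x ξ, R < ‖x‖ → m i x (h i x ξ) = 0) :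
    IsAmplitude R fun i x ξ => m i x (h i x ξ) := by
  refine ⟨⟨fun i => ((hm i).comp contDiff_fst).clm_apply (H.smooth i), fun k j => ?_⟩, hs⟩
  choose c hc using hmb
  choose C hC using H.bound
  let B : (F →L[ℝ] F') →L[ℝ] (V [×j]→L[ℝ] F) →L[ℝ] (V [×j]→L[ℝ] F') :=
    ContinuousLinearMap.compContinuousMultilinearMapL ℝ (fun _ : Fin j => V) F F'
  refine ⟨max (‖B‖ * ∑ l ∈ Finset.range (k + 1), (k.choose l : ℝ) * c l * C (k - l) j) 0,
    fun i x ξ => ?_⟩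
  rcases lt_or_ge R ‖x‖ with hx | hx
  · rw [iteratedFDeriv_iteratedFDeriv_eq_zero (hs i) k j hx ξ, norm_zero]
    exact le_max_right _ _
  · refine le_max_of_le_left ?_
    have hB : (fun x' => iteratedFDeriv ℝ j (fun ξ => m i x' (h i x' ξ)) ξ) =
        fun x' => B (m i x') (iteratedFDeriv ℝ j (h i x') ξ) := by
      ext1 x'
      exact (m i x').iteratedFDeriv_comp_left (n := j)
        ((contDiff_right (H.smooth i) x').contDiffAt.of_le (by exact_mod_cast le_top)) le_rfl
    rw [hB]
    refine (B.norm_iteratedFDeriv_le_of_bilinear (hm i)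
      (contDiff_iteratedFDeriv_right (H.smooth i) j ξ) x (n := k)
      (by exact_mod_cast le_top)).trans ?_
    gcongr with l
    · exact mul_nonneg (Nat.cast_nonneg _) ((norm_nonneg _).trans (hc l i x hx))
    · exact hc l i x hx
    · exact hC _ _ i x ξ

theorem norm_iteratedFDeriv_iteratedFDeriv_zero (g : V → V → F) (k : ℕ) (x ξ : V) :
    ‖iteratedFDeriv ℝ k (fun x' => iteratedFDeriv ℝ 0 (g x') ξ) x‖ =
      ‖iteratedFDeriv ℝ k (fun x' => g x' ξ) x‖ := by
  simp only [iteratedFDeriv_zero_eq_comp, Function.comp_apply]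
  exact (continuousMultilinearCurryFin0 ℝ V F).symm.norm_iteratedFDeriv_comp_left
    (fun x' => g x' ξ) x k

theorem IsAmplitude.exists_norm_le_indicator (H : IsAmplitude R h) :
    ∃ C, ∀ i x ξ, ‖h i x ξ‖ ≤ (Metric.closedBall (0 : V) R).indicator (fun _ => C) x := by
  obtain ⟨C, hC⟩ := H.bound 0 0
  simp only [norm_iteratedFDeriv_zero] at hC
  refine ⟨C, fun i x ξ => ?_⟩
  by_cases hx : x ∈ Metric.closedBall (0 : V) R
  · simpa only [indicator_of_mem hx] using hC i x ξ
  · rw [indicator_of_notMem hx, H.supp i x ξ (by simpa using hx), norm_zero]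

theorem IsAmplitude.exists_pow_mul_bound_left (H : IsAmplitude R h) (k m : ℕ) :
    ∃ C, ∀ i x ξ, ‖x‖ ^ k * ‖iteratedFDeriv ℝ m (fun x' => h i x' ξ) x‖ ≤ C := by
  obtain ⟨C, hC⟩ := H.bound m 0
  refine ⟨|R| ^ k * |C|, fun i x ξ => ?_⟩
  rw [← norm_iteratedFDeriv_iteratedFDeriv_zero]
  rcases lt_or_ge R ‖x‖ with hx | hx
  · rw [iteratedFDeriv_iteratedFDeriv_eq_zero (H.supp i) m 0 hx ξ, norm_zero, mul_zero]
    positivity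
  · gcongr
    · exact hx.trans (le_abs_self R)
    · exact (hC i x ξ).trans (le_abs_self C)

end Amplitude

section Oscillatory

set_option maxSynthPendingDepth 3

universe w

variable {ι : Type*} {V F : Type w} [NormedAddCommGroup V] [InnerProductSpace ℝ V]
  [NormedAddCommGroup F] [NormedSpace ℂ F] {h : ι → V → V → F} {R : ℝ}

/-- The amplitude of the derivative of the oscillatory integral `∫ e^{2πi x·ξ} g(x, ξ) dx`. -/
def oscDeriv (g : V → V → F) (x ξ : V) : V →L[ℝ] F :=
  fderiv ℝ (g x) ξ + (innerSL ℝ x).smulRight ((2 * Real.pi * Complex.I : ℂ) • g x ξ)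

theorem IsAmplitude.isAmplitude_oscDeriv (H : IsAmplitude R h) :
    IsAmplitude R fun i => oscDeriv (h i) := by
  let κ : F →L[ℝ] F := ContinuousLinearMap.lsmul ℝ ℂ (2 * Real.pi * Complex.I : ℂ)
  let M : V →L[ℝ] F →L[ℝ] V →L[ℝ] F :=
    ((ContinuousLinearMap.compL ℝ F F (V →L[ℝ] F)).flip κ) ∘L
      (ContinuousLinearMap.smulRightL ℝ V F) ∘L (innerSL ℝ)
  have hphase : IsAmplitude R fun i x ξ => M x (h i x ξ) := by
    refine H.isAmplitude_clm_apply (m := fun _ => M) (fun _ => M.contDiff) (fun k => ?_)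
      fun i x ξ hx => by rw [H.supp i x ξ hx, map_zero]
    obtain ⟨p, C, hC⟩ := M.hasTemperateGrowth.2 k
    refine ⟨|C| * (1 + |R|) ^ p, fun _ x hx => (hC x).trans ?_⟩
    gcongr
    · exact le_abs_self C
    · exact hx.trans (le_abs_self R)
  refine ⟨H.fderiv_right.add hphase.toIsSymbolFamily, fun i x ξ hx => ?_⟩
  rw [oscDeriv, funext fun ξ => H.supp i x ξ hx]
  simp

theorem hasFDerivAt_exp_inner_smul {g : V → V → F} {v w : V} (hg : DifferentiableAt ℝ (g v) w) :
    HasFDerivAt (fun w => Complex.exp (↑(2 * Real.pi * inner ℝ v w) * Complex.I) • g v w)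
      (Complex.exp (↑(2 * Real.pi * inner ℝ v w) * Complex.I) • oscDeriv g v w) w := by
  have hphase : HasFDerivAt (fun w : V => ((2 * Real.pi * inner ℝ v w : ℝ) : ℂ) * Complex.I)
      (((2 * Real.pi) • innerSL ℝ v).smulRight Complex.I) w :=
    (((2 * Real.pi) • innerSL ℝ v).smulRight Complex.I).hasFDerivAt.congr_of_eventuallyEq
      (Eventually.of_forall fun z => by simp)
  refine (hphase.cexp.smul hg.hasFDerivAt).congr_fderiv ?_
  ext z
  simp only [Complex.ofReal_mul, Complex.ofReal_ofNat, add_apply, smul_apply,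
    ContinuousLinearMap.smulRight_apply, coe_innerSL_apply, smul_eq_mul, Complex.real_smul,
    oscDeriv, smul_add, add_right_inj]
  module

variable [FiniteDimensional ℝ V] [MeasurableSpace V] [BorelSpace V]

/-- The oscillatory integral `∫ e^{2πi x·ξ} g(x, ξ) dx`. -/
def osc (g : V → V → F) (ξ : V) : F := 𝓕⁻ (fun x => g x ξ) ξ

theorem IsAmplitude.exists_pow_mul_norm_osc_le (H : IsAmplitude R h) (k : ℕ) :
    ∃ C, ∀ i ξ, ‖ξ‖ ^ k * ‖osc (h i) ξ‖ ≤ C := by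
  let ψ : ι × V → 𝓢(V, F) := fun q =>
    { toFun := fun x => h q.1 x q.2
      smooth' := contDiff_left (H.smooth q.1) q.2
      decay' := fun k m => (H.exists_pow_mul_bound_left k m).imp fun C hC x => hC q.1 x q.2 }
  have hψ : Bornology.IsVonNBounded ℂ (range ψ) :=
    isVonNBounded_range_schwartz_iff.2 fun k m =>
      (H.exists_pow_mul_bound_left k m).imp fun C hC q x => hC q.1 x q.2
  have himage := hψ.image (FourierTransform.fourierInvCLM ℂ 𝓢(V, F))
  rw [← range_comp] at himage
  obtain ⟨C, hC⟩ := isVonNBounded_range_schwartz_iff.1 himage k 0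
  refine ⟨C, fun i ξ => ?_⟩
  have hξ := hC (i, ξ) ξ
  rw [norm_iteratedFDeriv_zero, Function.comp_apply, FourierTransform.fourierInvCLM_apply,
    SchwartzMap.fourierInv_coe] at hξ
  exact hξ

theorem IsAmplitude.hasFDerivAt_osc (H : IsAmplitude R h) (i : ι) (ξ : V) :
    HasFDerivAt (osc (h i)) (osc (oscDeriv (h i)) ξ) ξ := by
  have H' := H.isAmplitude_oscDeriv
  obtain ⟨C, hC⟩ := H.exists_norm_le_indicator
  obtain ⟨C', hC'⟩ := H'.exists_norm_le_indicator
  have hball (c : ℝ) : Integrable ((Metric.closedBall (0 : V) R).indicator fun _ => c) :=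
    (integrable_indicator_iff Metric.isClosed_closedBall.measurableSet).2
      (integrableOn_const (isCompact_closedBall _ _).measure_lt_top.ne)
  have hexp (w : V) : Continuous fun v : V =>
      Complex.exp (↑(2 * Real.pi * inner ℝ v w) * Complex.I) := by fun_prop
  have hmeas (w : V) : AEStronglyMeasurable
      (fun v => Complex.exp (↑(2 * Real.pi * inner ℝ v w) * Complex.I) • h i v w) volume :=
    ((hexp w).smul (contDiff_left (H.smooth i) w).continuous).aestronglyMeasurable
  have hosc {G : Type w} [NormedAddCommGroup G] [NormedSpace ℂ G] (g : V → V → G) : osc g =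
      fun w => ∫ v, Complex.exp (↑(2 * Real.pi * inner ℝ v w) * Complex.I) • g v w :=
    funext fun _ => Real.fourierInv_eq' _ _
  rw [hosc, hosc]
  refine hasFDerivAt_integral_of_dominated_of_fderiv_le (𝕜 := ℝ) univ_mem
    (Eventually.of_forall hmeas) ?_
    ((hexp ξ).smul (contDiff_left (H'.smooth i) ξ).continuous).aestronglyMeasurable
    (ae_of_all _ fun v w _ => ?_) (hball C')
    (ae_of_all _ fun v w _ => hasFDerivAt_exp_inner_smul
      ((contDiff_right (H.smooth i) v).differentiable (by simp) w))
  · refine (hball C).mono' (hmeas ξ) (ae_of_all _ fun v => ?_)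
    rw [norm_smul, Complex.norm_exp_ofReal_mul_I, one_mul]
    exact hC i v ξ
  · rw [norm_smul, Complex.norm_exp_ofReal_mul_I, one_mul]
    exact hC' i v w

theorem IsAmplitude.contDiff_osc {F : Type w} [NormedAddCommGroup F] [NormedSpace ℂ F]
    {h : ι → V → V → F} (H : IsAmplitude R h) (i : ι) : ContDiff ℝ ∞ (osc (h i)) := by
  rw [contDiff_infty]
  intro m
  induction m generalizing F with
  | zero =>
    exact contDiff_zero.2
      (continuous_iff_continuousAt.2 fun ξ => (H.hasFDerivAt_osc i ξ).continuousAt)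
  | succ m ih =>
    exact contDiff_succ_iff_hasFDerivAt.2 ⟨_, ih H.isAmplitude_oscDeriv, H.hasFDerivAt_osc i⟩

theorem IsAmplitude.exists_bound_osc {F : Type w} [NormedAddCommGroup F] [NormedSpace ℂ F]
    {h : ι → V → V → F} (H : IsAmplitude R h) (k m : ℕ) :
    ∃ C, ∀ i ξ, ‖ξ‖ ^ k * ‖iteratedFDeriv ℝ m (osc (h i)) ξ‖ ≤ C := by
  induction m generalizing F with
  | zero => simpa only [norm_iteratedFDeriv_zero] using H.exists_pow_mul_norm_osc_le k
  | succ m ih =>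
    refine (ih H.isAmplitude_oscDeriv).imp fun C hC i ξ => ?_
    rw [← norm_iteratedFDeriv_fderiv, funext fun ξ => (H.hasFDerivAt_osc i ξ).fderiv]
    exact hC i ξ

end Oscillatory

section Transpose

variable {n : ℕ} {I J : Set ℝ} {W : Set (ℝ × E n)} {σ : ℝ → E n → E n → ℂ} {φ : ℝ × E n → ℂ}

theorem one_le_bracket (x : E n) : 1 ≤ bracket x := by
  rw [bracket, Real.one_le_sqrt]
  nlinarith [sq_nonneg ‖x‖]

theorem IsSymbolZero.isSymbolFamily_indicator (h : IsSymbolZero I σ) (hI : IsOpen I)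
    (hJ : IsCompact J) (hJI : J ⊆ I) : IsSymbolFamily (J.indicator σ) := by
  refine ⟨fun t => ?_, fun k j => ?_⟩
  · by_cases ht : t ∈ J
    · rw [indicator_of_mem ht]
      refine contDiff_iff_contDiffAt.2 fun p => ContDiffAt.comp p
        (g := fun p : ℝ × E n × E n => σ p.1 p.2.1 p.2.2) (f := fun p => (t, p)) ?_
        (contDiffAt_const.prodMk contDiffAt_id)
      exact h.smooth.contDiffAt ((hI.prod isOpen_univ).mem_nhds ⟨hJI ht, trivial⟩)
    · rw [indicator_of_notMem ht]
      exact contDiff_const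
  · obtain ⟨C, hC⟩ := h.bound 0 k j J hJ hJI
    refine ⟨max C 0, fun t x ξ => ?_⟩
    by_cases ht : t ∈ J
    · rw [indicator_of_mem ht]
      refine le_max_of_le_left (le_trans ?_ (hC t ht x ξ))
      rw [iteratedDeriv_zero]
      exact le_mul_of_one_le_left (norm_nonneg _)
        (one_le_mul_of_one_le_of_one_le (one_le_pow₀ (one_le_bracket x))
          (one_le_pow₀ (one_le_bracket ξ)))
    · simp [indicator_of_notMem ht, Pi.zero_def]

theorem IsTest.exists_radius (h : IsTest W φ) : ∃ R : ℝ, ∀ t x, R < ‖x‖ → φ (t, x) = 0 := by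
  obtain ⟨R, hR⟩ := (h.compact.isCompact.image continuous_snd).isBounded.exists_norm_le
  exact ⟨R, fun t x hx => image_eq_zero_of_notMem_tsupport fun hp =>
    (hR x ⟨_, hp, rfl⟩).not_gt hx⟩

/-- The amplitude `σ(t, x, 2πξ) φ(t, x)`, whose oscillatory integral is the inverse Fourier
transform of `σ(t)^* φ(t, ·)`. -/
def pdoAmplitude (σ : ℝ → E n → E n → ℂ) (φ : ℝ × E n → ℂ) (t : ℝ) (x ξ : E n) : ℂ :=
  σ t x ((2 * Real.pi) • ξ) * φ (t, x)

theorem IsTest.exists_isAmplitude_pdoAmplitude (hφ : IsTest (cyl I univ) φ) (hσ : IsSymbolZero I σ)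
    (hI : IsOpen I) : ∃ R, IsAmplitude R (pdoAmplitude σ φ) := by
  obtain ⟨J, hJ, hJI, hJ0⟩ := hφ.exists_compact_time
  obtain ⟨R, hR⟩ := hφ.exists_radius
  let M : ℂ →L[ℝ] ℂ →L[ℝ] ℂ := (ContinuousLinearMap.mul ℝ ℂ).flip
  have hM : IsAmplitude R fun t x ξ => M (φ (t, x)) (J.indicator σ t x ((2 * Real.pi) • ξ)) := by
    refine ((hσ.isSymbolFamily_indicator hI hJ hJI).comp_smul_right _).isAmplitude_clm_apply
      (m := fun t x => M (φ (t, x))) (fun t => M.contDiff.comp (hφ.contDiff_slice t)) (fun k => ?_)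
      fun t x ξ hx => by rw [hR t x hx, map_zero, zero_apply]
    obtain ⟨C, hC⟩ := hφ.exists_bound_slice 0 k
    refine ⟨‖M‖ * C, fun t x _ => (M.norm_iteratedFDeriv_comp_left
      (hφ.contDiff_slice t).contDiffAt (by exact_mod_cast le_top)).trans ?_⟩
    gcongr
    simpa using hC t x
  refine ⟨R, ?_⟩
  convert hM using 1
  ext t x ξ
  by_cases ht : t ∈ J
  · rw [indicator_of_mem ht]
    rfl
  · simp [pdoAmplitude, hJ0 t ht, M]

theorem IsTest.stronglyMeasurable_osc_pdoAmplitude (hφ : IsTest (cyl I univ) φ)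
    (hσ : IsSymbolZero I σ) (hI : IsOpen I) :
    StronglyMeasurable fun p : ℝ × E n => osc (pdoAmplitude σ φ p.1) p.2 := by
  let D : Set ((ℝ × E n) × E n) := {q | q.1.1 ∈ I}
  have hD : IsOpen D := hI.preimage (continuous_fst.comp continuous_fst)
  have hproj : Continuous fun q : (ℝ × E n) × E n => (q.1.1, q.2) := by fun_prop
  have hσD : ContinuousOn (fun q : (ℝ × E n) × E n => σ q.1.1 q.2 ((2 * Real.pi) • q.1.2)) D :=
    hσ.smooth.continuousOn.comp
      (f := fun q : (ℝ × E n) × E n => (q.1.1, q.2, (2 * Real.pi) • q.1.2))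
      (by fun_prop) fun q hq => ⟨hq, trivial⟩
  refine stronglyMeasurable_fourierInv (h := fun p : ℝ × E n => fun x => pdoAmplitude σ φ p.1 x p.2)
    (Continuous.stronglyMeasurable ?_)
  refine ContinuousOn.continuous_of_tsupport_subset
    (hσD.mul (hφ.smooth.continuous.comp hproj).continuousOn) hD fun q hq => ?_
  exact (hφ.supp (tsupport_comp_subset_preimage φ hproj (tsupport_mul_subset_right hq))).1

theorem IsTest.exists_isTestCurve_pdoTranspose (hφ : IsTest (cyl I univ) φ) (hσ : IsSymbolZero I σ)
    (hI : IsOpen I) :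
    ∃ Ψ, IsTestCurve I Ψ ∧ ∀ t, ⇑(Ψ t) = pdoTranspose (σ t) fun x => φ (t, x) := by
  obtain ⟨J, hJ, hJI, hJ0⟩ := hφ.exists_compact_time
  obtain ⟨R, hR⟩ := hφ.exists_isAmplitude_pdoAmplitude hσ hI
  let G : ℝ → 𝓢(E n, ℂ) := fun t =>
    { toFun := osc (pdoAmplitude σ φ t)
      smooth' := hR.contDiff_osc t
      decay' := fun k m => (hR.exists_bound_osc k m).imp fun C hC => hC t }
  have hG : IsTestCurve I G :=
    { isVonNBounded_range := isVonNBounded_range_schwartz_iff.2 hR.exists_bound_osc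
      stronglyMeasurable := hφ.stronglyMeasurable_osc_pdoAmplitude hσ hI
      exists_compact := by
        refine ⟨J, hJ, hJI, fun t ht => SchwartzMap.ext fun ξ => ?_⟩
        change osc (pdoAmplitude σ φ t) ξ = 0
        simp [osc, Real.fourierInv_eq', pdoAmplitude, hJ0 t ht] }
  exact ⟨_, hG.fourier, fun t => SchwartzMap.fourier_coe (G t)⟩

theorem IsTest.exists_isTestCurve_transpose (hφ : IsTest (cyl I univ) φ) {b : ZeroTerm n}
    (hb : b.Admissible I) (hI : IsOpen I) :
    ∃ Ψ, IsTestCurve I Ψ ∧ ∀ t, ⇑(Ψ t) = b.transpose t fun x => φ (t, x) :=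
  match b with
  | .mul _ =>
    have h := hφ.mul_left (hI.prod isOpen_univ) hb
    ⟨h.slice, h.isTestCurve_slice, fun _ => rfl⟩
  | .pdo _ => hφ.exists_isTestCurve_pdoTranspose hb hI

end Transpose

section Curves

variable {n : ℕ} {I U V : Set ℝ} {s₁ s₂ : ℝ} {a φ : ℝ × E n → ℂ} {A : Fin n → ℝ × E n → ℂ}
  {b : ZeroTerm n} {f u w : ℝ → 𝓢'(E n, ℂ)}

theorem pair_eq {v : 𝓢'(E n, ℂ)} {g : E n → ℂ} {ψ : 𝓢(E n, ℂ)} (h : ⇑ψ = g) : pair v g = v ψ := by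
  have hex : ∃ ψ : 𝓢(E n, ℂ), ⇑ψ = g := ⟨ψ, h⟩
  rw [pair, dif_pos hex, DFunLike.coe_injective (hex.choose_spec.trans h.symm)]

theorem IsTest.pair_slice (hφ : IsTest (cyl I univ) φ) (v : 𝓢'(E n, ℂ)) (t : ℝ) :
    pair v (fun x => φ (t, x)) = v (hφ.slice t) :=
  pair_eq rfl

theorem IsTest.integrable_pair_slice (hφ : IsTest (cyl I univ) φ)
    (hu : LocallyIntegrableSobolev I s₁ s₂ u) :
    Integrable fun t => pair (u t) fun x => φ (t, x) := by
  simpa only [hφ.pair_slice] using hu.integrable_apply hφ.isTestCurve_slice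

theorem IsTest.pair_slice_eq_zero (hφ : IsTest (cyl I univ) φ) {t : ℝ} (ht : t ∉ I)
    (v : 𝓢'(E n, ℂ)) : pair v (fun x => φ (t, x)) = 0 := by
  rw [hφ.pair_slice, hφ.isTestCurve_slice.eq_zero ht, map_zero]

theorem IsTest.integrable_pair_transpose (hφ : IsTest (cyl I univ) φ) (hI : IsOpen I)
    (hb : b.Admissible I) (hu : LocallyIntegrableSobolev I s₁ s₂ u) :
    Integrable fun t => pair (u t) (b.transpose t fun x => φ (t, x)) := by
  obtain ⟨Ψ, hΨ, hΨb⟩ := hφ.exists_isTestCurve_transpose hb hI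
  simpa only [pair_eq (hΨb _)] using hu.integrable_apply hΨ

theorem IsTest.pair_transpose_eq_zero (hφ : IsTest (cyl I univ) φ) (hI : IsOpen I)
    (hb : b.Admissible I) {t : ℝ} (ht : t ∉ I) (v : 𝓢'(E n, ℂ)) :
    pair v (b.transpose t fun x => φ (t, x)) = 0 := by
  obtain ⟨Ψ, hΨ, hΨb⟩ := hφ.exists_isTestCurve_transpose hb hI
  rw [pair_eq (hΨb t), hΨ.eq_zero ht, map_zero]

theorem isDistSolCurve_iff (hI : IsOpen I) (ha : ContDiffOn ℝ ∞ a (cyl I univ))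
    (hA : ∀ j, ContDiffOn ℝ ∞ (A j) (cyl I univ)) (hb : b.Admissible I) :
    IsDistSolCurve I a A b f u ↔ ∀ φ, IsTest (cyl I univ) φ →
      ∫ t, (pair (u t) (fun x => vfTranspose a A φ (t, x)) +
        pair (u t) (b.transpose t fun x => φ (t, x))) = ∫ t, pair (f t) fun x => φ (t, x) := by
  refine forall₂_congr fun φ hφ => ?_
  have hX := hφ.vfTranspose (hI.prod isOpen_univ) ha hA
  rw [setIntegral_eq_integral_of_forall_compl_eq_zero fun t ht => by
      rw [hX.pair_slice_eq_zero ht, hφ.pair_transpose_eq_zero hI hb ht, add_zero],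
    setIntegral_eq_integral_of_forall_compl_eq_zero fun t ht => hφ.pair_slice_eq_zero ht _]

theorem IsDistSolCurve.congr (h : IsDistSolCurve I a A b f u) (hI : MeasurableSet I)
    (huw : EqOn u w I) : IsDistSolCurve I a A b f w := fun φ hφ => by
  rw [← h φ hφ]
  exact setIntegral_congr_fun hI fun t ht => by simp only [huw ht]

theorem transpose_const_mul (b : ZeroTerm n) (t : ℝ) (c : ℂ) (g : E n → ℂ) :
    b.transpose t (fun x => c * g x) = fun x => c * b.transpose t g x := by
  cases b with
  | mul b => exact funext fun x => mul_left_comm _ _ _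
  | pdo σ =>
    ext y
    simp only [ZeroTerm.transpose, pdoTranspose, Real.fourier_eq', Real.fourierInv_eq',
      mul_left_comm _ c, smul_eq_mul, integral_const_mul]

theorem ZeroTerm.Admissible.mono (hb : b.Admissible I) (hU : U ⊆ I) : b.Admissible U :=
  match b with
  | .mul _ => ContDiffOn.mono hb (prod_mono_left hU)
  | .pdo _ =>
    { smooth := hb.smooth.mono (prod_mono_left hU)
      bound := fun k i j J hJ hJU => hb.bound k i j J hJ (hJU.trans hU) }

theorem IsDistSolCurve.union (hU : IsOpen U) (hV : IsOpen V) (hUV : Disjoint U V)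
    (ha : ContDiffOn ℝ ∞ a (cyl (U ∪ V) univ)) (hA : ∀ j, ContDiffOn ℝ ∞ (A j) (cyl (U ∪ V) univ))
    (hb : b.Admissible (U ∪ V)) (hf : LocallyIntegrableSobolev (U ∪ V) s₁ s₂ f)
    (hu : LocallyIntegrableSobolev (U ∪ V) s₁ s₂ u) (h₁ : IsDistSolCurve U a A b f u)
    (h₂ : IsDistSolCurve V a A b f u) : IsDistSolCurve (U ∪ V) a A b f u := by
  intro φ hφ
  have hP : Integrable fun t => pair (u t) (fun x => vfTranspose a A φ (t, x)) +
      pair (u t) (b.transpose t fun x => φ (t, x)) :=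
    ((hφ.vfTranspose ((hU.union hV).prod isOpen_univ) ha hA).integrable_pair_slice hu).add
      (hφ.integrable_pair_transpose (hU.union hV) hb hu)
  have hR := hφ.integrable_pair_slice hf
  have hpiece {S : Set ℝ} (hS : IsOpen S)
      (hφS : IsTest (cyl S univ) ((cyl S univ).indicator φ)) (h : IsDistSolCurve S a A b f u) :
      ∫ t in S, (pair (u t) (fun x => vfTranspose a A φ (t, x)) +
        pair (u t) (b.transpose t fun x => φ (t, x))) =
      ∫ t in S, pair (f t) fun x => φ (t, x) := by
    have hslice : ∀ t ∈ S, ∀ x, (cyl S univ).indicator φ (t, x) = φ (t, x) := fun t ht x =>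
      indicator_of_mem (s := cyl S univ) ⟨ht, mem_univ x⟩ φ
    have hX : ∀ t ∈ S, ∀ x,
        vfTranspose a A ((cyl S univ).indicator φ) (t, x) = vfTranspose a A φ (t, x) :=
      fun t ht x => vfTranspose_congr <| by
        filter_upwards [(hS.prod isOpen_univ).mem_nhds ⟨ht, mem_univ x⟩] with q hq
        exact indicator_of_mem hq φ
    refine Eq.trans (setIntegral_congr_fun hS.measurableSet fun t ht => ?_) <|
      (h _ hφS).trans (setIntegral_congr_fun hS.measurableSet fun t ht => ?_)
    · simp only [hslice t ht, hX t ht]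
    · simp only [hslice t ht]
  have hcyl : cyl (U ∪ V) univ = cyl U (univ : Set (E n)) ∪ cyl V univ := union_prod
  have hopenU : IsOpen (cyl U (univ : Set (E n))) := hU.prod isOpen_univ
  have hopenV : IsOpen (cyl V (univ : Set (E n))) := hV.prod isOpen_univ
  have hdisj : Disjoint (cyl U (univ : Set (E n))) (cyl V univ) := hUV.set_prod_left _ _
  rw [hcyl] at hφ
  rw [setIntegral_union hUV hV.measurableSet hP.integrableOn hP.integrableOn,
    setIntegral_union hUV hV.measurableSet hR.integrableOn hR.integrableOn]
  exact congrArg₂ (· + ·) (hpiece hU (hφ.indicator hopenU hopenV hdisj) h₁)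
    (hpiece hV ((union_comm _ _ ▸ hφ).indicator hopenV hopenU hdisj.symm) h₂)

theorem IsTest.pair_vfTranspose_add_transpose_mul_time (hφ : IsTest (cyl I univ) φ) (hI : IsOpen I)
    (ha : ContDiffOn ℝ ∞ a (cyl I univ)) (hA : ∀ j, ContDiffOn ℝ ∞ (A j) (cyl I univ))
    (hb : b.Admissible I) {χ : ℝ → ℝ} (hχ : ContDiff ℝ ∞ χ) (v : 𝓢'(E n, ℂ)) (t : ℝ) :
    pair v (fun x => Gluing.vfTranspose a A (fun q => χ q.1 * φ q) (t, x)) +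
        pair v (b.transpose t fun x => χ t * φ (t, x)) =
      χ t • (pair v (fun x => Gluing.vfTranspose a A φ (t, x)) +
        pair v (b.transpose t fun x => φ (t, x))) -
      deriv χ t • pair v fun x => a (t, x) * φ (t, x) := by
  have hW : IsOpen (cyl I (univ : Set (E n))) := hI.prod isOpen_univ
  have hX := hφ.vfTranspose hW ha hA
  have haφ := hφ.mul_left hW ha
  obtain ⟨Ψ, -, hΨ⟩ := hφ.exists_isTestCurve_transpose hb hI
  have hXχ : ⇑((χ t : ℂ) • hX.slice t - ((deriv χ t : ℝ) : ℂ) • haφ.slice t) =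
      fun x => Gluing.vfTranspose a A (fun q => χ q.1 * φ q) (t, x) :=
    funext fun x => (hφ.vfTranspose_mul_time hW ha hA hχ (t, x)).symm
  have hΨχ : ⇑((χ t : ℂ) • Ψ t) = b.transpose t fun x => χ t * φ (t, x) := by
    rw [transpose_const_mul, ← hΨ]
    rfl
  rw [pair_eq hXχ, pair_eq hΨχ, hX.pair_slice, haφ.pair_slice, pair_eq (hΨ t), map_sub, map_smul,
    map_smul, map_smul]
  simp only [smul_eq_mul, Complex.real_smul]
  ring

theorem IsDistSolCurve.of_sdiff_time (hI : IsOpen I) (ha : ContDiffOn ℝ ∞ a (cyl I univ))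
    (hA : ∀ j, ContDiffOn ℝ ∞ (A j) (cyl I univ)) (hb : b.Admissible I)
    (hf : LocallyIntegrableSobolev I s₁ s₂ f) (hu : LocallyIntegrableSobolev I s₁ s₂ u) {t₀ : ℝ}
    (h : IsDistSolCurve (I \ {t₀}) a A b f u)
    (hflux : ∀ φ, IsTest (cyl I univ) φ →
      Tendsto (fun t => pair (u t) fun x => a (t, x) * φ (t, x)) (𝓝[≠] t₀) (𝓝 0)) :
    IsDistSolCurve I a A b f u := by
  refine (isDistSolCurve_iff hI ha hA hb).2 fun φ hφ => ?_
  have hW : IsOpen (cyl I (univ : Set (E n))) := hI.prod isOpen_univ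
  have hsub : cyl (I \ {t₀}) (univ : Set (E n)) ⊆ cyl I univ := prod_mono_left sdiff_subset
  refine integral_eq_of_forall_cutoff (t₀ := t₀)
    (((hφ.vfTranspose hW ha hA).integrable_pair_slice hu).add
      (hφ.integrable_pair_transpose hI hb hu))
    (hφ.integrable_pair_slice hf) ((hφ.mul_left hW ha).integrable_pair_slice hu)
    (hflux φ hφ) fun χ hχ hχt₀ => ?_
  have hcyl : cyl (I \ {t₀}) (univ : Set (E n)) = cyl I univ \ Prod.fst ⁻¹' {t₀} := by
    ext p
    simp [cyl]
  have hweak := (isDistSolCurve_iff (hI.sdiff isClosed_singleton) (ha.mono hsub)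
    (fun j => (hA j).mono hsub) (hb.mono sdiff_subset)).1 h _ (hcyl ▸ hφ.mul_time hχ hχt₀)
  simp only [hφ.pair_vfTranspose_add_transpose_mul_time hI ha hA hb hχ] at hweak
  refine hweak.trans (integral_congr_ae <| .of_forall fun t => ?_)
  have hφχ : ⇑((χ t : ℂ) • hφ.slice t) = fun x => χ t * φ (t, x) := rfl
  simp only [pair_eq hφχ, hφ.pair_slice, map_smul, smul_eq_mul, Complex.real_smul]

variable {δ : ℝ} {up um : ℝ → 𝓢'(E n, ℂ)}

theorem glueDist_of_pos {t : ℝ} (ht : 0 < t) : glueDist up um t = up t :=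
  if_pos ht

theorem glueDist_of_neg {t : ℝ} (ht : t < 0) : glueDist up um t = um t := by
  rw [glueDist, if_neg (not_lt.2 ht.le), if_pos ht]

theorem integrableSobolev_glueDist (hp : IntegrableSobolev (Ioo 0 δ) s₁ s₂ up)
    (hm : IntegrableSobolev (Ioo (-δ) 0) s₁ s₂ um) :
    IntegrableSobolev (Ioo (-δ) δ) s₁ s₂ (glueDist up um) := by
  obtain ⟨gp, hgp, hup⟩ := hp
  obtain ⟨gm, hgm, hum⟩ := hm
  let g : ℝ → Lp ℂ 2 (volume : Measure (E n)) := (Ioi 0).piecewise gp gm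
  have hg_pos : EqOn g gp (Ioo 0 δ) := fun t ht => piecewise_eq_of_mem _ _ _ ht.1
  have hg_neg : EqOn g gm (Ioo (-δ) 0) := fun t ht =>
    piecewise_eq_of_notMem _ _ _ (notMem_Ioi.2 ht.2.le)
  have hIoo : (Ioo (-δ) δ : Set ℝ) =ᵐ[volume] (Ioo 0 δ ∪ Ioo (-δ) 0 : Set ℝ) :=
    Ioo_sdiff_zero δ ▸ (sdiff_null_ae_eq_self (measure_singleton 0)).symm
  refine ⟨g, IntegrableOn.congr_set_ae ?_ hIoo, ?_⟩
  · exact (hgp.congr_fun hg_pos.symm measurableSet_Ioo).union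
      (hgm.congr_fun hg_neg.symm measurableSet_Ioo)
  rw [Measure.restrict_congr_set hIoo, ae_restrict_union_iff]
  constructor
  · filter_upwards [hup, ae_restrict_mem measurableSet_Ioo] with t h ht
    rwa [glueDist_of_pos ht.1, hg_pos ht]
  · filter_upwards [hum, ae_restrict_mem measurableSet_Ioo] with t h ht
    rwa [glueDist_of_neg ht.2, hg_neg ht]

theorem IsDistSolCurve.glueDist (ha : ContDiffOn ℝ ∞ a (cyl (Ioo (-δ) δ) univ))
    (hA : ∀ j, ContDiffOn ℝ ∞ (A j) (cyl (Ioo (-δ) δ) univ)) (hb : b.Admissible (Ioo (-δ) δ))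
    (hf : LocallyIntegrableSobolev (Ioo (-δ) δ) s₁ s₂ f)
    (hu : LocallyIntegrableSobolev (Ioo (-δ) δ) s₁ s₂ (glueDist up um))
    (hp : IsDistSolCurve (Ioo 0 δ) a A b f up) (hm : IsDistSolCurve (Ioo (-δ) 0) a A b f um)
    (hfluxp : ∀ φ, IsTest (cyl (Ioo (-δ) δ) univ) φ →
      Tendsto (fun t => pair (up t) fun x => a (t, x) * φ (t, x)) (𝓝[>] 0) (𝓝 0))
    (hfluxm : ∀ φ, IsTest (cyl (Ioo (-δ) δ) univ) φ →
      Tendsto (fun t => pair (um t) fun x => a (t, x) * φ (t, x)) (𝓝[<] 0) (𝓝 0)) :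
    IsDistSolCurve (Ioo (-δ) δ) a A b f (Gluing.glueDist up um) := by
  refine .of_sdiff_time isOpen_Ioo ha hA hb hf hu (t₀ := 0) ?_ fun φ hφ =>
    tendsto_nhdsNE_of_sides (fun t ht => by rw [glueDist_of_pos ht])
      (fun t ht => by rw [glueDist_of_neg ht]) (hfluxp φ hφ) (hfluxm φ hφ)
  have hsub : Ioo 0 δ ∪ Ioo (-δ) 0 ⊆ Ioo (-δ) δ := (Ioo_sdiff_zero δ).ge.trans sdiff_subset
  have hcyl : cyl (Ioo 0 δ ∪ Ioo (-δ) 0) (univ : Set (E n)) ⊆ cyl (Ioo (-δ) δ) univ :=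
    prod_mono_left hsub
  rw [Ioo_sdiff_zero]
  exact .union isOpen_Ioo isOpen_Ioo (disjoint_Ioo_zero δ) (ha.mono hcyl)
    (fun j => (hA j).mono hcyl) (hb.mono hsub) (hf.mono hsub) (hu.mono hsub)
    (hp.congr measurableSet_Ioo fun t ht => (glueDist_of_pos ht.1).symm)
    (hm.congr measurableSet_Ioo fun t ht => (glueDist_of_neg ht.2).symm)

end Curves

end Gluing

end

open Gluing in
theorem lemma3p2_general {n : ℕ} {δ : ℝ} {Ω : Set (E n)} (hΩ : IsOpen Ω)
    (a : ℝ × E n → ℂ) (A : Fin n → ℝ × E n → ℂ)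
    (ha : ContDiffOn ℝ ∞ a (cyl (Ioo (-δ) δ) Ω))
    (hA : ∀ j, ContDiffOn ℝ ∞ (A j) (cyl (Ioo (-δ) δ) Ω)) :
    (∀ b f up um : ℝ × E n → ℂ,
      ContDiffOn ℝ ∞ b (cyl (Ioo (-δ) δ) Ω) →
      LocallyIntegrableOn f (cyl (Ioo (-δ) δ) Ω) →
      IsDistSol (cyl (Ioo 0 δ) Ω) a A b f up →
      IsDistSol (cyl (Ioo (-δ) 0) Ω) a A b f um →
      (∀ K : Set (E n), IsCompact K → K ⊆ Ω → IntegrableOn up (cyl (Ioo 0 δ) K)) →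
      (∀ K : Set (E n), IsCompact K → K ⊆ Ω → IntegrableOn um (cyl (Ioo (-δ) 0) K)) →
      (∀ φ : ℝ × E n → ℂ, IsTest (cyl (Ioo (-δ) δ) Ω) φ →
        Tendsto (fun t : ℝ => ∫ x, a (t, x) * up (t, x) * φ (t, x)) (𝓝[>] 0) (𝓝 0)) →
      (∀ φ : ℝ × E n → ℂ, IsTest (cyl (Ioo (-δ) δ) Ω) φ →
        Tendsto (fun t : ℝ => ∫ x, a (t, x) * um (t, x) * φ (t, x)) (𝓝[<] 0) (𝓝 0)) →
      LocallyIntegrableOn (glue up um) (cyl (Ioo (-δ) δ) Ω) ∧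
      (∀ K : Set (E n), IsCompact K → K ⊆ Ω →
        IntegrableOn (glue up um) (cyl (Ioo (-δ) δ) K)) ∧
      IsDistSol (cyl (Ioo (-δ) δ) Ω) a A b f (glue up um)) ∧
    (Ω = univ → ∀ (s₁ s₂ : ℝ) (b : ZeroTerm n) (f up um : ℝ → 𝓢'(E n, ℂ)),
      b.Admissible (Ioo (-δ) δ) →
      LocallyIntegrableSobolev (Ioo (-δ) δ) s₁ s₂ f →
      IsDistSolCurve (Ioo 0 δ) a A b f up →
      IsDistSolCurve (Ioo (-δ) 0) a A b f um →
      IntegrableSobolev (Ioo 0 δ) s₁ s₂ up →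
      IntegrableSobolev (Ioo (-δ) 0) s₁ s₂ um →
      (∀ φ : ℝ × E n → ℂ, IsTest (cyl (Ioo (-δ) δ) univ) φ →
        Tendsto (fun t : ℝ => pair (up t) (fun x => a (t, x) * φ (t, x))) (𝓝[>] 0) (𝓝 0)) →
      (∀ φ : ℝ × E n → ℂ, IsTest (cyl (Ioo (-δ) δ) univ) φ →
        Tendsto (fun t : ℝ => pair (um t) (fun x => a (t, x) * φ (t, x))) (𝓝[<] 0) (𝓝 0)) →
      IntegrableSobolev (Ioo (-δ) δ) s₁ s₂ (glueDist up um) ∧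
      IsDistSolCurve (Ioo (-δ) δ) a A b f (glueDist up um)) := by
  refine ⟨fun b f up um hb hf hp hm hip him hfluxp hfluxm => ?_, ?_⟩
  · have hint : ∀ K : Set (E n), IsCompact K → K ⊆ Ω →
        IntegrableOn (glue up um) (cyl (Ioo (-δ) δ) K) := fun K hK hKΩ =>
      integrableOn_glue hK.measurableSet (hip K hK hKΩ) (him K hK hKΩ)
    have hloc := locallyIntegrableOn_cyl isOpen_Ioo hΩ hint
    exact ⟨hloc, hint, .glue hΩ ha hA hb hf hloc hp hm hfluxp hfluxm⟩
  · rintro rfl s₁ s₂ b f up um hb hf hp hm hip him hfluxp hfluxm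
    have hint := integrableSobolev_glueDist hip him
    exact ⟨hint, .glueDist ha hA hb hf hint.locallyIntegrableSobolev hp hm hfluxp hfluxm⟩

open Gluing in
theorem lemma3p2 {n : ℕ} {δ : ℝ} (hδ : 0 < δ) {Ω : Set (E n)} (hΩ : IsOpen Ω)
    (a : ℝ × E n → ℂ) (A : Fin n → ℝ × E n → ℂ)
    (ha : ContDiffOn ℝ ∞ a (cyl (Ioo (-δ) δ) Ω))
    (hA : ∀ j, ContDiffOn ℝ ∞ (A j) (cyl (Ioo (-δ) δ) Ω))
    (ha0 : ∀ x ∈ Ω, a (0, x) = 0) :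
    -- smooth solutions on the two sides, with a smooth function `b`
    (∀ b f up um : ℝ × E n → ℂ,
      ContDiffOn ℝ ∞ b (cyl (Ioo (-δ) δ) Ω) →
      ContDiffOn ℝ ∞ f (cyl (Ioo (-δ) δ) Ω) →
      ContDiffOn ℝ ∞ up (cyl (Ioo 0 δ) Ω) →
      ContDiffOn ℝ ∞ um (cyl (Ioo (-δ) 0) Ω) →
      (∀ p ∈ cyl (Ioo 0 δ) Ω, vf a A up p + b p * up p = f p) →
      (∀ p ∈ cyl (Ioo (-δ) 0) Ω, vf a A um p + b p * um p = f p) →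
      (∀ K : Set (E n), IsCompact K → K ⊆ Ω → IntegrableOn up (cyl (Ioo 0 δ) K)) →
      (∀ K : Set (E n), IsCompact K → K ⊆ Ω → IntegrableOn um (cyl (Ioo (-δ) 0) K)) →
      (∀ φ : ℝ × E n → ℂ, IsTest (cyl (Ioo (-δ) δ) Ω) φ →
        Tendsto (fun t : ℝ => ∫ x, a (t, x) * up (t, x) * φ (t, x)) (𝓝[>] 0) (𝓝 0)) →
      (∀ φ : ℝ × E n → ℂ, IsTest (cyl (Ioo (-δ) δ) Ω) φ →
        Tendsto (fun t : ℝ => ∫ x, a (t, x) * um (t, x) * φ (t, x)) (𝓝[<] 0) (𝓝 0)) →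
      LocallyIntegrableOn (glue up um) (cyl (Ioo (-δ) δ) Ω) ∧
      (∀ K : Set (E n), IsCompact K → K ⊆ Ω →
        IntegrableOn (glue up um) (cyl (Ioo (-δ) δ) K)) ∧
      IsDistSol (cyl (Ioo (-δ) δ) Ω) a A b f (glue up um)) ∧
    -- `H^{s₁,s₂}`-valued solutions on the two sides, with `b` smooth or of order zero in `x`
    (Ω = univ → ∀ (s₁ s₂ : ℝ) (b : ZeroTerm n) (f up um : ℝ → 𝓢'(E n, ℂ)),
      b.Admissible (Ioo (-δ) δ) →
      ContinuousSobolev (Ioo (-δ) δ) s₁ s₂ f →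
      ContinuousSobolev (Ioo 0 δ) s₁ s₂ up →
      ContinuousSobolev (Ioo (-δ) 0) s₁ s₂ um →
      IsDistSolCurve (Ioo 0 δ) a A b f up →
      IsDistSolCurve (Ioo (-δ) 0) a A b f um →
      IntegrableSobolev (Ioo 0 δ) s₁ s₂ up →
      IntegrableSobolev (Ioo (-δ) 0) s₁ s₂ um →
      (∀ φ : ℝ × E n → ℂ, IsTest (cyl (Ioo (-δ) δ) univ) φ →
        Tendsto (fun t : ℝ => pair (up t) (fun x => a (t, x) * φ (t, x))) (𝓝[>] 0) (𝓝 0)) →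
      (∀ φ : ℝ × E n → ℂ, IsTest (cyl (Ioo (-δ) δ) univ) φ →
        Tendsto (fun t : ℝ => pair (um t) (fun x => a (t, x) * φ (t, x))) (𝓝[<] 0) (𝓝 0)) →
      IntegrableSobolev (Ioo (-δ) δ) s₁ s₂ (glueDist up um) ∧
      IsDistSolCurve (Ioo (-δ) δ) a A b f (glueDist up um)) := by
  obtain ⟨hfun, hcurve⟩ := lemma3p2_general hΩ a A ha hA
  refine ⟨fun b f up um hb hf hup hum hp hm => ?_, fun h s₁ s₂ b f up um hb hf _ _ =>
    hcurve h s₁ s₂ b f up um hb hf.locallyIntegrableSobolev⟩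
  have hsub := (cyl_sdiff_zero δ Ω).ge.trans sdiff_subset
  have hsubp := subset_union_left.trans hsub
  have hsubm := subset_union_right.trans hsub
  exact hfun b f up um hb
    (hf.continuousOn.locallyIntegrableOn (isOpen_Ioo.prod hΩ).measurableSet)
    (isDistSol_of_classical (isOpen_Ioo.prod hΩ) (ha.mono hsubp) (fun j => (hA j).mono hsubp)
      (hb.mono hsubp) (hf.mono hsubp) hup hp)
    (isDistSol_of_classical (isOpen_Ioo.prod hΩ) (ha.mono hsubm) (fun j => (hA j).mono hsubm)
      (hb.mono hsubm) (hf.mono hsubm) hum hm)
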